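/- Let $r\ge 2$ be an integer, let $M$ be a finite-dimensional (Hausdorff, second countable, not necessarily compact) Riemannian manifold of class $C^r$ without boundary, with a continuous Riemannian metric, and let $d$ be its Riemannian distance. Let $f:M\to M$ be a $C^r$ diffeomorphism and let $\Lambda\subset M$ be a compact set with $f(\Lambda)=\Lambda$ that is transitive: some point of $\Lambda$ has a forward orbit $\{f^n(z):n\ge 0\}$ dense in $\Lambda$. **Partially hyperbolic.** Suppose that $\Lambda$ is partially hyperbolic: $T_\Lambda M=E^s\oplus E^c\oplus E^u$ with continuous $Df$-invariant sub-bundles over $\Lambda$ (each possibly of rank $0$) such that, for some $C>0$ and $0<\lambda<1$, all $x\in\Lambda$ and all $n\ge 0$, $\|Df^n_x v\|\le C\lambda^n\|v\|$ for $v\in E^s(x)$ and $\|Df^{-n}_x v\|\le C\lambda^n\|v\|$ for $v\in E^u(x)$, and such that for all $x\in\Lambda$ $$\|D_xf|_{E^s}\|<\|D_{f(x)}f^{-1}|_{E^c}\|^{-1},\qquad \|D_xf|_{E^c}\|<\|D_{f(x)}f^{-1}|_{E^u}\|^{-1},$$ where an inequality that involves a zero bundle is considered to hold. Suppose that $\dim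 E^c(x)=1$ for all $x\in\Lambda$. **Orientation.** Suppose that $\Lambda$ is $E^c$-orientable and that $f$ preserves the orientation: there are a continuous vector field $X$ on $\Lambda$ with $X(x)\in E^c(x)$ and $\|X(x)\|=1$, and a continuous function $a:\Lambda\to(0,\infty)$ with $Df_x(X(x))=a(x)X(f(x))$ for all $x\in\Lambda$. **Hölder stability.** Suppose that, for some $\alpha>1/2$, $\Lambda$ is $\alpha$-Hölder stable under $C^r$ perturbations: there are a neighbourhood $\mathcal U(f)$ of $f$ in the set of $C^r$ diffeomorphisms of $M$ with the strong $C^r$ topology and a constant $C>0$ such that for every $g\in\mathcal U(f)$ there is a homeomorphism $\varphi$ of $\Lambda$ onto its image in $M$ with $\varphi\circ f|_\Lambda=g\circ\varphi$ and $$\sup_{x\in\Lambda} d(\varphi(x),x)\le C\,d_{C^r}(f,g)^\alpha .$$ Here $d_{C^r}$ is a $C^r$ distance measured in charts, as follows. Choose countably many charts $\chi_i$ of the $C^r$ manifold $M$ with $C^{r+1}$ changes of charts, a locally finite cover of $M$ by compact sets $K_i$ (possibly empty) with $K_i$ in the domain of $\chi_i$, indices $t(i)$ such that $f(K_i)$ lies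 in the domain of $\chi_{t(i)}$, and weights $w_i>0$; then $$d_{C^r}(f,g)=\sup_i\ \max_{k\le r}\ \sup_{y\in\chi_i(K_i)} w_i\,\bigl\|D^k(\chi_{t(i)}\circ f\circ\chi_i^{-1})(y)-D^k(\chi_{t(i)}\circ g\circ\chi_i^{-1})(y)\bigr\|,$$ for $g$ such that $g(K_i)$ lies in the domain of $\chi_{t(i)}$ for all $i$, and $\mathcal U(f)$ consists of the $C^r$ diffeomorphisms $g$ with this property and $d_{C^r}(f,g)<\varepsilon$, for some $\varepsilon>0$. It is enough that the stability holds for one choice of these data. (If $M$ is compact this is the usual $C^r$ topology, and any two such distances made of $C^{r+1}$-compatible charts are Lipschitz equivalent near $f$.) Then $\Lambda$ is a hyperbolic set of $f$: there are continuous $Df$-invariant sub-bundles $F^s,F^u$ over $\Lambda$ with $T_\Lambda M=F^s\oplus F^u$, and constants $C'>0$ and $0<\mu<1$, such that for all $x\in\Lambda$ and $n\ge 0$, $\|Df^n_x v\|\le C'\mu^n\|v\|$ for $v\in F^s(x)$ and $\|Df^{-n}_x v\|\le C'\mu^n\|v\|$ for $v\in F^u(x)$. -/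

import Mathlib

open Set Filter Topology Manifold Bundle
open scoped NNReal ENNReal ContDiff

noncomputable section

namespace HolderStability

section Bundles

variable {E : Type*} [NormedAddCommGroup E] [NormedSpace ℝ E]
  {M : Type*} [TopologicalSpace M] [ChartedSpace E M] [IsManifold 𝓘(ℝ, E) 1 M]

/-- A vector field along `Λ` (its values off `Λ` are irrelevant) is continuous, as a map from `Λ`
to the tangent bundle. -/
def ContinuousField (Λ : Set M) (X : ∀ x : M, TangentSpace 𝓘(ℝ, E) x) : Prop :=
  ContinuousOn (fun x => (⟨x, X x⟩ : TangentBundle 𝓘(ℝ, E) M)) Λ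

/-- A (continuous) vector sub-bundle of `TM` over `Λ`: every point of `Λ` has a neighbourhood
in `Λ` over which the fibres have a frame made of continuous vector fields. The rank is locally
constant, and the fibres off `Λ` are irrelevant. -/
def IsSubbundle (Λ : Set M) (F : ∀ x : M, Submodule ℝ (TangentSpace 𝓘(ℝ, E) x)) : Prop :=
  ∀ x ∈ Λ, ∃ U ∈ 𝓝 x, ∃ (k : ℕ) (v : Fin k → ∀ y : M, TangentSpace 𝓘(ℝ, E) y),
    (∀ j, ContinuousField (U ∩ Λ) (v j)) ∧
    ∀ y ∈ U ∩ Λ, LinearIndependent ℝ (fun j => v j y) ∧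
      Submodule.span ℝ (range fun j => v j y) = F y

end Bundles

section Dynamics

variable {E : Type*} [NormedAddCommGroup E] [NormedSpace ℝ E]
  {M : Type*} [TopologicalSpace M] [ChartedSpace E M] {r : ℕ}

/-- The family of subspaces `F` is invariant under the derivative of `f` over `Λ`. -/
def IsDInvariant (f : M ≃ₘ^r⟮𝓘(ℝ, E), 𝓘(ℝ, E)⟯ M) (Λ : Set M)
    (F : ∀ x : M, Submodule ℝ (TangentSpace 𝓘(ℝ, E) x)) : Prop :=
  ∀ x ∈ Λ, (F x).map (mfderiv 𝓘(ℝ, E) 𝓘(ℝ, E) f x).toLinearMap = F (f x)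

/-- `Λ` is transitive: some point of `Λ` has a forward orbit that is dense in `Λ`. -/
def IsTransitive (f : M ≃ₘ^r⟮𝓘(ℝ, E), 𝓘(ℝ, E)⟯ M) (Λ : Set M) : Prop :=
  ∃ z ∈ Λ, Λ ⊆ closure (range fun n : ℕ => f^[n] z)

end Dynamics

section Splittings

variable {E : Type*} [NormedAddCommGroup E] [NormedSpace ℝ E]
  {M : Type*} [TopologicalSpace M] [ChartedSpace E M] [IsManifold 𝓘(ℝ, E) 1 M]
  [RiemannianBundle (fun x : M => TangentSpace 𝓘(ℝ, E) x)] {r : ℕ}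

/-- Vectors of `F` over `Λ` are (uniformly exponentially) contracted by the forward iterates
of the derivative of `f`. -/
def IsContracted (f : M ≃ₘ^r⟮𝓘(ℝ, E), 𝓘(ℝ, E)⟯ M) (Λ : Set M)
    (F : ∀ x : M, Submodule ℝ (TangentSpace 𝓘(ℝ, E) x)) : Prop :=
  ∃ C > (0 : ℝ), ∃ lam : ℝ, 0 < lam ∧ lam < 1 ∧ ∀ x ∈ Λ, ∀ v ∈ F x, ∀ n : ℕ,
    ‖mfderiv 𝓘(ℝ, E) 𝓘(ℝ, E) (f^[n]) x v‖ ≤ C * lam ^ n * ‖v‖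

/-- `Λ` is a hyperbolic set of `f`: `T_Λ M` is the direct sum of two `Df`-invariant sub-bundles,
one contracted by `f` and the other contracted by the inverse of `f`. -/
def IsHyperbolic (f : M ≃ₘ^r⟮𝓘(ℝ, E), 𝓘(ℝ, E)⟯ M) (Λ : Set M) : Prop :=
  ∃ Es Eu : ∀ x : M, Submodule ℝ (TangentSpace 𝓘(ℝ, E) x),
    IsSubbundle Λ Es ∧ IsSubbundle Λ Eu ∧
    IsDInvariant f Λ Es ∧ IsDInvariant f Λ Eu ∧
    (∀ x ∈ Λ, IsCompl (Es x) (Eu x)) ∧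
    IsContracted f Λ Es ∧ IsContracted f.symm Λ Eu

/-- `F` is dominated by `G` at the points of `Λ`, that is
`‖D_x f|F(x)‖ < ‖D_{f(x)} f⁻¹|G(f(x))‖⁻¹` (the largest stretch of a unit vector of `F(x)` is
smaller than the smallest stretch of a unit vector of `G(x)`). It holds by convention if one of
the two fibres is zero. -/
def IsDominatedBy (f : M ≃ₘ^r⟮𝓘(ℝ, E), 𝓘(ℝ, E)⟯ M) (Λ : Set M)
    (F G : ∀ x : M, Submodule ℝ (TangentSpace 𝓘(ℝ, E) x)) : Prop :=
  ∀ x ∈ Λ, ∀ u ∈ F x, ∀ v ∈ G x, ‖u‖ = 1 → ‖v‖ = 1 →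
    ‖mfderiv 𝓘(ℝ, E) 𝓘(ℝ, E) f x u‖ < ‖mfderiv 𝓘(ℝ, E) 𝓘(ℝ, E) f x v‖

/-- `T_Λ M = Es ⊕ Ec ⊕ Eu` is a partially hyperbolic splitting of `f` over `Λ`. -/
structure IsPartiallyHyperbolic (f : M ≃ₘ^r⟮𝓘(ℝ, E), 𝓘(ℝ, E)⟯ M) (Λ : Set M)
    (Es Ec Eu : ∀ x : M, Submodule ℝ (TangentSpace 𝓘(ℝ, E) x)) : Prop where
  subbundle_s : IsSubbundle Λ Es
  subbundle_c : IsSubbundle Λ Ec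
  subbundle_u : IsSubbundle Λ Eu
  invariant_s : IsDInvariant f Λ Es
  invariant_c : IsDInvariant f Λ Ec
  invariant_u : IsDInvariant f Λ Eu
  disjoint_s_c : ∀ x ∈ Λ, Disjoint (Es x) (Ec x)
  isCompl_sc_u : ∀ x ∈ Λ, IsCompl (Es x ⊔ Ec x) (Eu x)
  contracted_s : IsContracted f Λ Es
  contracted_u : IsContracted f.symm Λ Eu
  dominated_s_c : IsDominatedBy f Λ Es Ec
  dominated_c_u : IsDominatedBy f Λ Ec Eu

/-- `X` is an orientation of the (line) bundle `F` over `Λ`: a continuous vector field on `Λ` of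
unit vectors of `F`. -/
def IsOrientation (Λ : Set M) (F : ∀ x : M, Submodule ℝ (TangentSpace 𝓘(ℝ, E) x))
    (X : ∀ x : M, TangentSpace 𝓘(ℝ, E) x) : Prop :=
  ContinuousField Λ X ∧ ∀ x ∈ Λ, X x ∈ F x ∧ ‖X x‖ = 1

/-- `f` preserves the orientation `X`: `Df_x (X x) = a x • X (f x)` on `Λ`, with `a : Λ → ℝ`
continuous and positive. -/
def PreservesOrientation (f : M ≃ₘ^r⟮𝓘(ℝ, E), 𝓘(ℝ, E)⟯ M) (Λ : Set M)
    (X : ∀ x : M, TangentSpace 𝓘(ℝ, E) x) : Prop :=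
  ∃ a : M → ℝ, ContinuousOn a Λ ∧ ∀ x ∈ Λ, 0 < a x ∧
    mfderiv 𝓘(ℝ, E) 𝓘(ℝ, E) f x (X x) = a x • X (f x)

end Splittings

section CrTopology

variable (E : Type*) [NormedAddCommGroup E] [NormedSpace ℝ E]
  (M : Type*) [TopologicalSpace M] [ChartedSpace E M]

/-- The data by which `C^r` distances and neighbourhoods are measured: charts `χ i` of the `C^r`
manifold `M`, a locally finite cover of `M` by compact sets `K i` with `K i` in the domain of
`χ i`, for each `i` the index `t i` of the chart in which the images of `K i` are read, and
positive weights `w i`. Only finitely many `K i` are non-empty if `M` is compact.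

The changes of charts are asked to be `C^(r+1)`, so that two such distances made of compatible
charts are Lipschitz equivalent when `M` is compact (`C^r` changes of charts only give the same
topology). If `M` is a `C^(r+1)` or a smooth manifold, its charts do. -/
structure CrGauge (r : ℕ) where
  χ : ℕ → OpenPartialHomeomorph M E
  K : ℕ → Set M
  t : ℕ → ℕ
  w : ℕ → ℝ≥0
  χ_mem : ∀ i, χ i ∈ IsManifold.maximalAtlas 𝓘(ℝ, E) r M
  χ_compat : ∀ i j, (χ i).symm.trans (χ j) ∈ contDiffGroupoid ((r + 1 : ℕ) : ℕ∞ω) 𝓘(ℝ, E)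
  isCompact_K : ∀ i, IsCompact (K i)
  K_subset : ∀ i, K i ⊆ (χ i).source
  locallyFinite_K : LocallyFinite K
  iUnion_K : ⋃ i, K i = univ
  w_pos : ∀ i, 0 < w i

variable {E M} {r : ℕ}

namespace CrGauge

/-- `g` maps each `K i` into the domain of the chart in which the image is read. -/
def Adapted (A : CrGauge E M r) (g : M → M) : Prop :=
  ∀ i, MapsTo g (A.K i) (A.χ (A.t i)).source

/-- The map `g` read in the charts of index `i`, near `χ i (K i)`. -/
def local_rep (A : CrGauge E M r) (g : M → M) (i : ℕ) : E → E :=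
  A.χ (A.t i) ∘ g ∘ (A.χ i).symm

/-- The (weighted) `C^r` distance between two adapted maps: the supremum over `i`, over
`x ∈ K i` and over `k ≤ r` of the distance between the derivatives of order `k` in charts. -/
def crDist (A : CrGauge E M r) (f g : M → M) : ℝ≥0∞ :=
  ⨆ (i : ℕ) (k : ℕ) (_ : k ≤ r) (x : M) (_ : x ∈ A.K i),
    (A.w i : ℝ≥0∞) * edist (iteratedFDeriv ℝ k (A.local_rep f i) (A.χ i x))
      (iteratedFDeriv ℝ k (A.local_rep g i) (A.χ i x))

end CrGauge

end CrTopology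

section Stability

variable {E : Type*} [NormedAddCommGroup E] [NormedSpace ℝ E]
  {M : Type*} [EMetricSpace M] [ChartedSpace E M] {r : ℕ}

/-- `Λ` is `α`-Hölder stable under `C^r` perturbations: for all `C^r` diffeomorphisms `g` in some
neighbourhood of `f` in the (strong) `C^r` topology there is a homeomorphism `φ` of `Λ` onto its
image in `M` with `φ ∘ f = g ∘ φ` on `Λ` and `d(φ, inclusion) ≤ C d(f, g) ^ α`, with `C`
independent of `g`. The sets `{g | A.Adapted g ∧ A.crDist f g < ε}`, with `A` any gauge to which
`f` is adapted, are a basis of neighbourhoods of `f` for the strong `C^r` topology, which is the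
usual one when `M` is compact. -/
def IsHolderStable (f : M ≃ₘ^r⟮𝓘(ℝ, E), 𝓘(ℝ, E)⟯ M) (Λ : Set M) (α : ℝ) : Prop :=
  ∃ A : CrGauge E M r, A.Adapted f ∧ ∃ ε > (0 : ℝ≥0), ∃ C > (0 : ℝ≥0),
    ∀ g : M ≃ₘ^r⟮𝓘(ℝ, E), 𝓘(ℝ, E)⟯ M, A.Adapted g → A.crDist f g < ε →
      ∃ φ : Λ → M, IsEmbedding φ ∧
        (∀ (x : Λ) (hx : f x ∈ Λ), φ ⟨f x, hx⟩ = g (φ x)) ∧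
        ∀ x : Λ, edist (φ x) (x : M) ≤ C * (A.crDist f g) ^ α

end Stability

end HolderStability

end

/-! Push `f` along the centre direction and see what the conjugacies are forced to do. Let g be `f`
followed by a shift of size ε, cut off by a bump function inside one chart. Then d(f, g) = O(ε), so
the conjugacy φ moves points by O(ε^α). Follow the dense orbit x_n = f^n(z) and the g-orbit y_n =
φ(x_n). Let θ be the coordinate along `X` in the splitting Es ⊕ ℝX ⊕ Eu. Invariance of the summands
gives θ ∘ Df = a θ (`IsCentreForm.apply_mfderiv`). Taylor's formula in charts then shows that u_n =
θ(y_n - x_n) satisfies u_(n+1) = a(x_n) u_n + ε b(x_(n+1)) + O((ε + ε^α)^2), where b is θ of the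
field of the shift (`eventually_step_le`). Since 2α > 1, the error is o(ε)
(`eventually_sq_add_rpow_le`).

One shift acts in one chart only. But the approximate equation is linear, so solutions for finitely
many shifts add up, and the total b is at least 1/4 on all of `Λ`
(`IsHolderStable.exists_isApproxSolvable`). For a fixed small ε this is a bounded sequence with
u_(n+1) ≥ a_n u_n + c and c > 0. Such a sequence forces the products of the a_n to decay or to grow
exponentially (`prod_decay_or_growth`): either u becomes nonnegative and then stays above c, or it
is negative forever. Density of the orbit carries the rate to `Λ` (`forall_mem_of_iterate_tail`),
and the centre line joins Es or Eu accordingly (`IsContracted.sup_span`).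

The delicate estimate is d(f, g) = O(ε) for `f` of class C^r only. The extra derivative that it
costs falls on the bump and on the C^(r+1) changes of charts, never on `f`. -/

noncomputable section

namespace HolderStability

/-! ### Scalar recurrences, uniform Taylor estimates and families of maps. -/

section Analysis

/-- A bounded solution of `u (n + 1) ≥ a n * u n + c` forces the products of the `a n` to decay
or to grow exponentially. -/
theorem prod_decay_or_growth {a u : ℕ → ℝ} {c K B : ℝ} (hc : 0 < c) (ha : ∀ n, 0 < a n)
    (haB : ∀ n, a n ≤ B) (hu : ∀ n, |u n| ≤ K) (h : ∀ n, a n * u n + c ≤ u (n + 1)) :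
    ∃ C > 0, ∃ μ : ℝ, 0 < μ ∧ μ < 1 ∧
      ((∃ N, ∀ n ≥ N, ∀ k, ∏ i ∈ Finset.range k, a (n + i) ≤ C * μ ^ k) ∨
        ∀ n k, 1 ≤ C * μ ^ k * ∏ i ∈ Finset.range k, a (n + i)) := by
  -- Nonnegativity is absorbing: as a_n > 0, one step from u N ≥ 0 already gives u ≥ c, and this
  -- persists.
  by_cases hN : ∃ N, 0 ≤ u N
  · obtain ⟨N, hN⟩ := hN
    have hpos : ∀ m, c ≤ u (N + 1 + m) := by
      intro m
      induction m with
      | zero => nlinarith [h N, mul_nonneg (ha N).le hN]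
      | succ m ih =>
        change c ≤ u (N + 1 + m + 1)
        nlinarith [h (N + 1 + m), ha (N + 1 + m)]
    have hpos' : ∀ n ≥ N + 1, c ≤ u n := fun n hn => by
      obtain ⟨m, rfl⟩ := Nat.exists_eq_add_of_le hn
      exact hpos m
    have hK : 0 < K := by
      have := hpos 0
      have := (abs_le.1 (hu (N + 1 + 0))).2
      linarith
    refine ⟨K / c, by positivity, K / (K + c), by positivity,
      (div_lt_one (by positivity)).2 (by linarith), Or.inl ⟨N + 1, fun n hn k => ?_⟩⟩
    -- Since u ≤ K, subtracting c costs a fixed proportion: a_n u_n ≤ u_(n+1) - c ≤ K/(K+c) u_(n+1).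
    -- Telescoping gives the rate, and c ≤ u ≤ K removes u.
    have key : (∏ i ∈ Finset.range k, a (n + i)) * u n ≤ (K / (K + c)) ^ k * u (n + k) := by
      induction k with
      | zero => simp
      | succ k ih =>
        have h1 : a (n + k) * u (n + k) ≤ K / (K + c) * u (n + (k + 1)) := by
          have h2 := (abs_le.1 (hu (n + (k + 1)))).2
          have h3 := h (n + k)
          rw [add_assoc] at h3
          have h4 : K / (K + c) * u (n + (k + 1)) = u (n + (k + 1)) - c * (u (n + (k + 1)) / (K + c)) := by
            field_simp; ring
          have h5 : u (n + (k + 1)) / (K + c) ≤ 1 := (div_le_one (by positivity)).2 (by linarith)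
          nlinarith
        rw [Finset.prod_range_succ, pow_succ]
        calc _ = a (n + k) * ((∏ i ∈ Finset.range k, a (n + i)) * u n) := by ring
          _ ≤ a (n + k) * ((K / (K + c)) ^ k * u (n + k)) := by
            gcongr
            exact (ha _).le
          _ = (K / (K + c)) ^ k * (a (n + k) * u (n + k)) := by ring
          _ ≤ (K / (K + c)) ^ k * (K / (K + c) * u (n + (k + 1))) := by gcongr
          _ = _ := by ring
    have h1 : 0 ≤ ∏ i ∈ Finset.range k, a (n + i) := Finset.prod_nonneg fun i _ => (ha _).le
    have h2 : (∏ i ∈ Finset.range k, a (n + i)) * c ≤ (K / (K + c)) ^ k * K :=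
      (mul_le_mul_of_nonneg_left (hpos' n hn) h1).trans
        (key.trans (by gcongr; exact (abs_le.1 (hu _)).2))
    rw [div_mul_eq_mul_div, le_div_iff₀ hc]
    linarith
  · push Not at hN
    have hK : 0 < K := by
      have := (abs_le.1 (hu 0)).1
      have := hN 0
      linarith
    have hB : 0 < B := (ha 0).trans_le (haB 0)
    refine ⟨K * B / c, by positivity, K / (K + c), by positivity,
      (div_lt_one (by positivity)).2 (by linarith), Or.inr fun n k => ?_⟩
    -- Mirror image for the positive sequence -u ≤ K, where a_n(-u_n) ≥ -u_(n+1) + c.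
    have key : -u (n + k) ≤ (K / (K + c)) ^ k * (∏ i ∈ Finset.range k, a (n + i)) * -u n := by
      induction k with
      | zero => simp
      | succ k ih =>
        have h1 : -u (n + (k + 1)) ≤ K / (K + c) * (a (n + k) * -u (n + k)) := by
          have h2 := (abs_le.1 (hu (n + (k + 1)))).1
          have h3 := h (n + k)
          rw [add_assoc] at h3
          rw [div_mul_eq_mul_div, le_div_iff₀ (by positivity)]
          nlinarith
        rw [Finset.prod_range_succ, pow_succ]
        refine h1.trans ?_
        calc K / (K + c) * (a (n + k) * -u (n + k))
            ≤ K / (K + c) * (a (n + k) *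
              ((K / (K + c)) ^ k * (∏ i ∈ Finset.range k, a (n + i)) * -u n)) := by
              gcongr
              exact (ha _).le
          _ = _ := by ring
    have h1 : 0 ≤ (K / (K + c)) ^ k * ∏ i ∈ Finset.range k, a (n + i) :=
      mul_nonneg (by positivity) (Finset.prod_nonneg fun i _ => (ha _).le)
    -- The next term is negative as well, so a(-u) > c; the bound on a then keeps -u away from zero.
    have h2 : c ≤ B * -u (n + k) := by
      nlinarith [h (n + k), hN (n + k), hN (n + k + 1), haB (n + k), ha (n + k)]
    have h3 : -u n ≤ K := by linarith [(abs_le.1 (hu n)).1]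
    have h4 : c ≤ B * ((K / (K + c)) ^ k * (∏ i ∈ Finset.range k, a (n + i)) * K) :=
      h2.trans (by gcongr; exact key.trans (by gcongr))
    rw [div_mul_eq_mul_div, div_mul_eq_mul_div, le_div_iff₀ hc]
    linarith

/-- A property that holds locally for all large constants holds for all large constants on a
compact set. -/
theorem eventually_atTop_forall_of_isCompact {X : Type*} [TopologicalSpace X] {s : Set X}
    (hs : IsCompact s) {P : ℝ → X → Prop}
    (h : ∀ p ∈ s, ∃ U ∈ 𝓝[s] p, ∀ᶠ K in atTop, ∀ x ∈ U, P K x) :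
    ∀ᶠ K in atTop, ∀ x ∈ s, P K x :=
  hs.induction_on (p := fun t => ∀ᶠ K in atTop, ∀ x ∈ t, P K x) (by simp)
    (fun _ _ hst ht => ht.mono fun _ hK x hx => hK x (hst hx))
    (fun _ _ hs ht => (hs.and ht).mono fun _ hK x hx => hx.elim (hK.1 x) (hK.2 x)) h

/-- One large `K` serves both as a bound and, through `K⁻¹`, as a radius of validity. All local
estimates take this form, so that finitely many of them hold together for a common `K`. -/
theorem eventually_atTop_ball_subset {X : Type*} [PseudoMetricSpace X] {x : X} {s : Set X}
    (hs : s ∈ 𝓝 x) : ∀ᶠ K : ℝ in atTop, Metric.ball x K⁻¹ ⊆ s := by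
  obtain ⟨δ, hδ, hb⟩ := Metric.mem_nhds_iff.1 hs
  filter_upwards [tendsto_inv_atTop_zero.eventually (ge_mem_nhds hδ)] with K hK
  exact (Metric.ball_subset_ball hK).trans hb

variable {E F G : Type*} [NormedAddCommGroup E] [NormedSpace ℝ E]
  [NormedAddCommGroup F] [NormedSpace ℝ F] [NormedAddCommGroup G] [NormedSpace ℝ G]

/-- First order Taylor formula with uniform quadratic remainder near a point. -/
theorem eventually_taylor_of_contDiffAt {f : F → G} {q₀ : F} (hf : ContDiffAt ℝ 2 f q₀) :
    ∀ᶠ K : ℝ in atTop, ∀ q ∈ Metric.ball q₀ K⁻¹, ∀ q' ∈ Metric.ball q₀ K⁻¹,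
      ‖f q' - f q - fderiv ℝ f q (q' - q)‖ ≤ K * ‖q' - q‖ ^ 2 := by
  obtain ⟨L, t, ht, hL⟩ :=
    ((hf.fderiv_right (m := 1) (by norm_num)).exists_lipschitzOnWith)
  have hd : ∀ᶠ q in 𝓝 q₀, DifferentiableAt ℝ f q :=
    (hf.eventually (by simp)).mono fun q hq => hq.differentiableAt (by simp)
  filter_upwards [eventually_atTop_ball_subset (inter_mem ht hd), eventually_ge_atTop (L : ℝ)]
    with K hK hLK q hq q' hq'
  have hseg : segment ℝ q q' ⊆ Metric.ball q₀ K⁻¹ := (convex_ball _ _).segment_subset hq hq'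
  -- On the segment the derivative differs from the one at q by at most K‖q' - q‖, because it is
  -- Lipschitz; the mean value inequality supplies the second factor.
  have := (convex_segment q q').norm_image_sub_le_of_norm_hasFDerivWithin_le'
    (f := f) (f' := fun x => fderiv ℝ f x) (φ := fderiv ℝ f q) (C := K * ‖q' - q‖)
    (fun x hx => (hK (hseg hx)).2.hasFDerivAt.hasFDerivWithinAt)
    (fun x hx => ?_) (left_mem_segment ℝ q q') (right_mem_segment ℝ q q')
  · rwa [mul_assoc, ← sq] at this
  · have h1 := hL.dist_le_mul x (hK (hseg hx)).1 q (hK hq).1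
    rw [dist_eq_norm, dist_eq_norm] at h1
    have h2 : ‖x - q‖ ≤ ‖q' - q‖ := by
      obtain ⟨s, hs, rfl⟩ := (segment_eq_image' ℝ q q' ▸ hx : x ∈ (fun θ : ℝ => q + θ • (q' - q)) '' Icc 0 1)
      simp only [add_sub_cancel_left, norm_smul, Real.norm_eq_abs, abs_of_nonneg hs.1]
      exact mul_le_of_le_one_left (norm_nonneg _) hs.2
    exact h1.trans (by gcongr; exact L.2.trans hLK)

/-- Each derivative in the space variable costs one degree of joint smoothness. The degree `m` is
quantified inside the induction because the step uses `m + 1`. -/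
theorem contDiffAt_iteratedFDeriv_param {f : ℝ → E → G} {p : ℝ × E} {k : ℕ} :
    ∀ {m : ℕ}, ContDiffAt ℝ ((m + k : ℕ) : ℕ∞ω) (Function.uncurry f) p →
      ContDiffAt ℝ m (fun q : ℝ × E => iteratedFDeriv ℝ k (f q.1) q.2) p := by
  induction k with
  | zero =>
    intro m hf
    exact (show ContDiffAt ℝ m _ p from hf).continuousLinearMap_comp
      ((continuousMultilinearCurryFin0 ℝ E G).symm : _ →L[ℝ] E [×0]→L[ℝ] G)
  | succ k ih =>
    intro m hf
    have h1 := ih (m := m + 1) (by convert hf using 2; ring)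
    have h2 : ContDiffAt ℝ m (fun q : ℝ × E =>
        fderiv ℝ ((fun (q : ℝ × E) (w : E) => iteratedFDeriv ℝ k (f q.1) w) q) q.2) p := by
      refine ContDiffAt.fderiv (n := ((m + 1 : ℕ) : ℕ∞ω)) ?_ contDiffAt_snd (by simp)
      exact h1.comp (p, p.2) (f := fun q : (ℝ × E) × E => (q.1.1, q.2))
        (by fun_prop)
    exact h2.continuousLinearMap_comp
      ((continuousMultilinearCurryLeftEquiv ℝ (fun _ : Fin (k + 1) => E) G).symm :
        _ →L[ℝ] E [×(k + 1)]→L[ℝ] G)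

/-- The derivatives of order at most `r` of a family of maps that vanishes at the parameter `0`
are of the order of the parameter, if the family is jointly of class `C^(r+1)`. -/
theorem eventually_iteratedFDeriv_le {f : ℝ → E → G} {w₀ : E} {r : ℕ}
    (hf : ContDiffAt ℝ ((r + 1 : ℕ) : ℕ∞ω) (Function.uncurry f) (0, w₀)) (hf0 : f 0 = 0) :
    ∀ᶠ K : ℝ in atTop, ∀ ε, |ε| < K⁻¹ → ∀ w ∈ Metric.ball w₀ K⁻¹, ∀ k ≤ r,
      ‖iteratedFDeriv ℝ k (f ε) w‖ ≤ K * |ε| := by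
  have key : ∀ k ∈ Iic r, ∀ᶠ K : ℝ in atTop, ∀ ε, |ε| < K⁻¹ → ∀ w ∈ Metric.ball w₀ K⁻¹,
      ‖iteratedFDeriv ℝ k (f ε) w‖ ≤ K * |ε| := by
    intro k hk
    -- The spare derivative makes the k-th derivative jointly C¹, hence Lipschitz in the parameter;
    -- comparing with the parameter 0, where it vanishes, gives O(ε).
    have h1 : ContDiffAt ℝ ((1 : ℕ) : ℕ∞ω) (fun q : ℝ × E => iteratedFDeriv ℝ k (f q.1) q.2) (0, w₀) :=
      contDiffAt_iteratedFDeriv_param (hf.of_le (by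
        have : k ≤ r := hk
        exact_mod_cast (by lia : 1 + k ≤ r + 1)))
    obtain ⟨L, t, ht, hL⟩ := (by simpa using h1 : ContDiffAt ℝ 1 _ _).exists_lipschitzOnWith
    filter_upwards [eventually_atTop_ball_subset ht, eventually_ge_atTop (L : ℝ),
      eventually_gt_atTop 0] with K hK hLK hK0 ε hε w hw
    have m1 : (ε, w) ∈ t := hK (by
      rw [← ball_prod_same]; exact ⟨by simpa using hε, hw⟩)
    have m2 : ((0 : ℝ), w) ∈ t := hK (by
      rw [← ball_prod_same]; exact ⟨by simpa using hK0, hw⟩)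
    have := hL.dist_le_mul _ m1 _ m2
    simp only [hf0, dist_eq_norm, Prod.mk_sub_mk, sub_zero, sub_self, Prod.norm_mk, norm_zero,
      Real.norm_eq_abs] at this
    rw [show iteratedFDeriv ℝ k (0 : E → G) w = 0 by
      rw [show (0 : E → G) = fun _ => 0 from rfl, iteratedFDeriv_fun_zero]; rfl, sub_zero,
      max_eq_left (abs_nonneg _)] at this
    exact this.trans (by gcongr)
  filter_upwards [(eventually_all_finite (finite_Iic r)).2 key] with K hK ε hε w hw k hk
  exact hK k hk ε hε w hw

end Analysis

/-! ### Continuity of forms determined by a frame. -/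

section LinearAlgebra

variable {E : Type*} [NormedAddCommGroup E] [NormedSpace ℝ E]

/-- A linear form that has constant values on a continuous frame is continuous. -/
theorem continuousWithinAt_of_apply_frame {X ι : Type*} [TopologicalSpace X] [Fintype ι]
    {s : Set X} {p : X} (hp : p ∈ s) {b : ι → X → E} (hb : ∀ i, ContinuousWithinAt (b i) s p)
    (hli : LinearIndependent ℝ fun i => b i p) (hsp : ⊤ ≤ Submodule.span ℝ (range fun i => b i p))
    {l : X → E →L[ℝ] ℝ} {c : ι → ℝ} (hl : ∀ᶠ q in 𝓝[s] p, ∀ i, l q (b i q) = c i) :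
    ContinuousWithinAt l s p := by
  classical
  -- `A q` sends coordinates to vectors of the frame at q. Then l = L ∘ A⁻¹ with `L` constant, and
  -- inversion is continuous at the isomorphism `A p`.
  let A : X → (ι → ℝ) →L[ℝ] E := fun q =>
    ∑ i, (ContinuousLinearMap.proj (R := ℝ) (φ := fun _ : ι => ℝ) i).smulRight (b i q)
  have hA : ContinuousWithinAt A s p := by
    refine tendsto_finsetSum _ fun i _ => ?_
    exact ((ContinuousLinearMap.smulRightL ℝ (ι → ℝ) E
      (ContinuousLinearMap.proj (R := ℝ) (φ := fun _ : ι => ℝ) i)).continuous.tendsto _).comp (hb i)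
  let e : (ι → ℝ) ≃L[ℝ] E := (Module.Basis.mk hli hsp).equivFun.symm.toContinuousLinearEquiv
  have hAe : A p = e := by
    ext v
    simp [A, e, Module.Basis.equivFun_symm_apply]
  let L : (ι → ℝ) →L[ℝ] ℝ :=
    ∑ i, (ContinuousLinearMap.proj (R := ℝ) (φ := fun _ : ι => ℝ) i).smulRight (c i)
  have hinv : ContinuousWithinAt (fun q => L ∘L (A q).inverse) s p := by
    have h1 : ContinuousAt ContinuousLinearMap.inverse (A p) := by
      rw [hAe]
      exact (contDiffAt_map_inverse (𝕜 := ℝ) (n := 0) e).continuousAt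
    exact ((ContinuousLinearMap.compL ℝ E (ι → ℝ) ℝ L).continuous.tendsto _).comp
      (h1.comp_continuousWithinAt hA)
  have hev : ∀ᶠ q in 𝓝[s] p, l q = L ∘L (A q).inverse := by
    have h2 : ∀ᶠ q in 𝓝[s] p, A q ∈ range ((↑) : ((ι → ℝ) ≃L[ℝ] E) → (ι → ℝ) →L[ℝ] E) :=
      hA.eventually (by
        rw [hAe]
        exact e.nhds)
    filter_upwards [hl, h2] with q hq ⟨e', he'⟩
    have h3 : l q ∘L A q = L := by
      ext v
      simp [A, L, map_sum, hq]
    rw [← h3, ← he', ContinuousLinearMap.inverse_equiv]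
    ext v
    simp
  exact hinv.congr_of_eventuallyEq hev (hev.self_of_nhdsWithin hp)

/-- A vector outside a subspace is detected by a linear form that vanishes on the subspace. -/
theorem exists_linearMap_eq_one {V : Type*} [AddCommGroup V] [Module ℝ V] {W : Submodule ℝ V}
    {x : V} (hx : x ∉ W) : ∃ θ : V →ₗ[ℝ] ℝ, θ x = 1 ∧ ∀ w ∈ W, θ w = 0 := by
  obtain ⟨g, hg, hW⟩ := W.exists_le_ker_of_notMem hx
  refine ⟨(g x)⁻¹ • g, by simp [hg], fun w hw => ?_⟩
  have : g w = 0 := hW hw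
  simp [this]

end LinearAlgebra

/-! ### Cut-off translations of the model space. -/

section Bump

variable {E : Type*} [NormedAddCommGroup E] [NormedSpace ℝ E]

/-- The displacement of points by `ε • ρ` in the direction `v`. -/
def bumpShift (ρ : E → ℝ) (v : E) (ε : ℝ) (w : E) : E := w + (ε * ρ w) • v

variable {ρ : E → ℝ} {v : E}

theorem bumpShift_zero : bumpShift ρ v 0 = id := by
  ext w; simp [bumpShift]

theorem bumpShift_of_notMem {ε : ℝ} {w : E} (hw : w ∉ tsupport ρ) : bumpShift ρ v ε w = w := by
  simp [bumpShift, image_eq_zero_of_notMem_tsupport hw]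

theorem contDiff_bumpShift {n : ℕ∞ω} (hρ : ContDiff ℝ n ρ) :
    ContDiff ℝ n (Function.uncurry (bumpShift ρ v)) := by
  have h : ContDiff ℝ n fun q : ℝ × E => ρ q.2 := hρ.comp contDiff_snd
  have : ContDiff ℝ n fun q : ℝ × E => q.2 + (q.1 * ρ q.2) • v := by fun_prop
  exact this

/-- The gradient of `ρ` enters multiplied by ε, so it disappears at ε = 0 and only the velocity `ρ w
• v` remains. -/
theorem hasFDerivAt_bumpShift (hρ : Differentiable ℝ ρ) (w : E) :
    HasFDerivAt (Function.uncurry (bumpShift ρ v))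
      (ContinuousLinearMap.snd ℝ ℝ E + ((ContinuousLinearMap.fst ℝ ℝ E).smulRight (ρ w • v)))
      ((0 : ℝ), w) := by
  have h : HasFDerivAt (fun q : ℝ × E => ρ q.2) ((fderiv ℝ ρ w).comp (.snd ℝ ℝ E)) ((0 : ℝ), w) :=
    (hρ w).hasFDerivAt.comp ((0 : ℝ), w) hasFDerivAt_snd
  have := hasFDerivAt_snd (𝕜 := ℝ) (p := ((0 : ℝ), w)) |>.add
    ((hasFDerivAt_fst (𝕜 := ℝ) (p := ((0 : ℝ), w)).mul h).smul_const v)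
  refine this.congr_fderiv ?_
  ext <;> simp [smul_smul]

/-- For small `ε` the displacement is a diffeomorphism. -/
theorem eventually_exists_bumpShift_equiv [FiniteDimensional ℝ E] (hρ : ContDiff ℝ ∞ ρ)
    (hc : HasCompactSupport ρ) (v : E) :
    ∀ᶠ K : ℝ in atTop, ∀ ε, |ε| < K⁻¹ → ∃ e : E ≃ E, ⇑e = bumpShift ρ v ε ∧
      ContDiff ℝ ∞ e ∧ ContDiff ℝ ∞ e.symm := by
  have : CompleteSpace E := FiniteDimensional.complete ℝ E
  obtain ⟨L, hL⟩ := (hρ.of_le (m := 1) (by simp)).lipschitzWith_of_hasCompactSupport hc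
    (by simp)
  filter_upwards [eventually_gt_atTop (2 * (L * ‖v‖ + 1)), eventually_gt_atTop 0] with K hK hK0 ε hε
  have hsm : ContDiff ℝ ∞ (bumpShift ρ v ε) :=
    (contDiff_bumpShift (v := v) hρ).comp (contDiff_const (c := ε) |>.prodMk contDiff_id)
  have hεK : |ε| * (L * ‖v‖) ≤ 1 / 2 := by
    have h1 : |ε| * K ≤ 1 := by
      have := mul_le_mul_of_nonneg_right hε.le hK0.le
      rwa [inv_mul_cancel₀ hK0.ne'] at this
    nlinarith [abs_nonneg ε]
  -- A 1/2-Lipschitz perturbation of the identity is a homeomorphism; the choice of `K` provides the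
  -- constant.
  have happ : ApproximatesLinearOn (bumpShift ρ v ε) (ContinuousLinearEquiv.refl ℝ E : E →L[ℝ] E)
      univ (1 / 2 : ℝ≥0) := by
    intro x _ y _
    have h1 := hL.dist_le_mul x y
    rw [Real.dist_eq, dist_eq_norm] at h1
    have h2 : bumpShift ρ v ε x - bumpShift ρ v ε y -
        (ContinuousLinearEquiv.refl ℝ E : E →L[ℝ] E) (x - y) = (ε * (ρ x - ρ y)) • v := by
      simp only [bumpShift, ContinuousLinearEquiv.coe_refl, ContinuousLinearMap.coe_id', id]
      module
    rw [h2, norm_smul, Real.norm_eq_abs, abs_mul]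
    calc |ε| * |ρ x - ρ y| * ‖v‖ ≤ |ε| * (L * ‖x - y‖) * ‖v‖ := by gcongr
      _ = |ε| * (L * ‖v‖) * ‖x - y‖ := by ring
      _ ≤ _ := by
        gcongr
        simpa using hεK
  have hN : Subsingleton E ∨ (1 / 2 : ℝ≥0) <
      ‖((ContinuousLinearEquiv.refl ℝ E).symm : E →L[ℝ] E)‖₊⁻¹ := by
    rcases subsingleton_or_nontrivial E with h | h
    · exact Or.inl h
    · right
      have : ‖((ContinuousLinearEquiv.refl ℝ E).symm : E →L[ℝ] E)‖₊ = 1 := by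
        exact NNReal.eq ContinuousLinearMap.norm_id
      rw [this]
      norm_num
  let h := happ.toHomeomorph _ hN
  have hh : ⇑h = bumpShift ρ v ε := rfl
  refine ⟨h.toEquiv, rfl, hsm, ?_⟩
  rw [contDiff_iff_contDiffAt]
  intro y
  obtain ⟨x, rfl⟩ := h.surjective y
  have hd := ((hsm.differentiable (by simp)) x).hasFDerivAt
  -- Smoothness of the inverse needs an invertible derivative. It is within 1/2 of the identity,
  -- hence injective, hence bijective by finite dimension.
  have hinv : ∃ e' : E ≃L[ℝ] E, (e' : E →L[ℝ] E) = fderiv ℝ (bumpShift ρ v ε) x := by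
    have hbound : ∀ u, ‖fderiv ℝ (bumpShift ρ v ε) x u - u‖ ≤ 1 / 2 * ‖u‖ := by
      have hd' : HasFDerivAt (fun z => bumpShift ρ v ε z - z)
          (fderiv ℝ (bumpShift ρ v ε) x - ContinuousLinearMap.id ℝ E) x := hd.sub (hasFDerivAt_id x)
      have hlip : LipschitzWith (1 / 2) fun z => bumpShift ρ v ε z - z := by
        refine LipschitzWith.of_dist_le_mul fun a b => ?_
        have := happ a trivial b trivial
        rw [dist_eq_norm, dist_eq_norm]
        rw [show bumpShift ρ v ε a - a - (bumpShift ρ v ε b - b) =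
          bumpShift ρ v ε a - bumpShift ρ v ε b - (a - b) by abel]
        exact this
      intro u
      have h1 := hd'.le_of_lipschitz hlip
      have h2 := (fderiv ℝ (bumpShift ρ v ε) x - ContinuousLinearMap.id ℝ E).le_of_opNorm_le h1 u
      simpa using h2
    have hinj : Function.Injective (fderiv ℝ (bumpShift ρ v ε) x) := by
      rw [injective_iff_map_eq_zero]
      intro u hu
      have := hbound u
      rw [hu, zero_sub, norm_neg] at this
      exact norm_le_zero_iff.1 (by linarith)
    exact ⟨(LinearEquiv.ofInjectiveEndo (fderiv ℝ (bumpShift ρ v ε) x).toLinearMap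
      hinj).toContinuousLinearEquiv, by ext; simp⟩
  obtain ⟨e', he'⟩ := hinv
  have hx : h.toOpenPartialHomeomorph.symm (h x) = x := h.symm_apply_apply x
  refine (h.toOpenPartialHomeomorph.contDiffAt_symm (f₀' := e') (a := h x) (mem_univ _) ?_ ?_ :)
  · rw [hx, he']
    exact hd
  · rw [hx]
    exact hsm.contDiffAt

end Bump

/-! ### Tangent vectors and maps read in charts. -/

section ChartDerivative

variable {E : Type*} [NormedAddCommGroup E] [NormedSpace ℝ E]
  {M : Type*} [TopologicalSpace M] [ChartedSpace E M]

/-- The derivative of a chart, with values in the model space. -/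
def chartDeriv (χ : OpenPartialHomeomorph M E) (x : M) : TangentSpace 𝓘(ℝ, E) x →L[ℝ] E :=
  mfderiv 𝓘(ℝ, E) 𝓘(ℝ, E) χ x

variable {χ χ' : OpenPartialHomeomorph M E} {x p : M}

theorem chartDeriv_bijective (hχ : χ ∈ IsManifold.maximalAtlas 𝓘(ℝ, E) 1 M) (hx : x ∈ χ.source) :
    Function.Bijective (chartDeriv χ x) := by
  have h : χ.MDifferentiable 𝓘(ℝ, E) 𝓘(ℝ, E) :=
    ⟨fun y hy => (mdifferentiableAt_of_mem_maximalAtlas hχ hy).mdifferentiableWithinAt,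
      fun y hy => (mdifferentiableAt_symm_of_mem_maximalAtlas hχ hy).mdifferentiableWithinAt⟩
  exact h.mfderiv_bijective hx

/-- The derivative of a map read in charts. -/
theorem fderiv_comp_chartDeriv (hχ : χ ∈ IsManifold.maximalAtlas 𝓘(ℝ, E) 1 M)
    (hχ' : χ' ∈ IsManifold.maximalAtlas 𝓘(ℝ, E) 1 M) {h : M → M}
    (hh : MDifferentiableAt 𝓘(ℝ, E) 𝓘(ℝ, E) h x) (hx : x ∈ χ.source) (hhx : h x ∈ χ'.source)
    (u : TangentSpace 𝓘(ℝ, E) x) :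
    fderiv ℝ (χ' ∘ h ∘ χ.symm) (χ x) (chartDeriv χ x u) =
      chartDeriv χ' (h x) (mfderiv 𝓘(ℝ, E) 𝓘(ℝ, E) h x u) := by
  have h1 : MDifferentiableAt 𝓘(ℝ, E) 𝓘(ℝ, E) χ x := mdifferentiableAt_of_mem_maximalAtlas hχ hx
  have h2 : MDifferentiableAt 𝓘(ℝ, E) 𝓘(ℝ, E) χ.symm (χ x) :=
    mdifferentiableAt_symm_of_mem_maximalAtlas hχ (χ.map_source hx)
  have h3 : MDifferentiableAt 𝓘(ℝ, E) 𝓘(ℝ, E) χ' (h x) :=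
    mdifferentiableAt_of_mem_maximalAtlas hχ' hhx
  have h4 : MDifferentiableAt 𝓘(ℝ, E) 𝓘(ℝ, E) (χ' ∘ h) x := h3.comp x hh
  have h5 : MDifferentiableAt 𝓘(ℝ, E) 𝓘(ℝ, E) (χ' ∘ h ∘ χ.symm) (χ x) := by
    refine MDifferentiableAt.comp (I' := 𝓘(ℝ, E)) (f := χ.symm) (g := χ' ∘ h) (χ x) ?_ h2
    rwa [χ.left_inv hx]
  have h6 : (χ' ∘ h ∘ χ.symm) ∘ χ =ᶠ[𝓝 x] χ' ∘ h := by
    filter_upwards [χ.open_source.mem_nhds hx] with y hy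
    simp [χ.left_inv hy]
  have h7 := h6.mfderiv_eq (I := 𝓘(ℝ, E)) (I' := 𝓘(ℝ, E))
  have h8 := congrArg (fun L => L u) h7
  have h9 := mfderiv_comp_apply x (I'' := 𝓘(ℝ, E)) h5 h1 u
  have h10 := mfderiv_comp_apply x (I'' := 𝓘(ℝ, E)) h3 hh u
  rw [mfderiv_eq_fderiv] at h9
  exact h9.symm.trans (h8.trans h10)

theorem contDiffAt_chart_comp {n : ℕ∞ω} (hχ : χ ∈ IsManifold.maximalAtlas 𝓘(ℝ, E) n M)
    (hχ' : χ' ∈ IsManifold.maximalAtlas 𝓘(ℝ, E) n M) {h : M → M}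
    (hh : ContMDiffAt 𝓘(ℝ, E) 𝓘(ℝ, E) n h x) (hx : x ∈ χ.source) (hhx : h x ∈ χ'.source) :
    ContDiffAt ℝ n (χ' ∘ h ∘ χ.symm) (χ x) := by
  rw [← contMDiffAt_iff_contDiffAt]
  have h2 : ContMDiffAt 𝓘(ℝ, E) 𝓘(ℝ, E) n χ.symm (χ x) :=
    contMDiffAt_symm_of_mem_maximalAtlas hχ (χ.map_source hx)
  have h3 : ContMDiffAt 𝓘(ℝ, E) 𝓘(ℝ, E) n χ' (h x) := contMDiffAt_of_mem_maximalAtlas hχ' hhx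
  refine ContMDiffAt.comp (I' := 𝓘(ℝ, E)) (f := χ.symm) (g := χ' ∘ h) (χ x) ?_ h2
  rw [χ.left_inv hx]
  exact h3.comp x hh

variable [IsManifold 𝓘(ℝ, E) 1 M]

/-- A continuous field read in a chart is continuous. -/
theorem continuousWithinAt_chartDeriv_apply (hχ : χ ∈ IsManifold.maximalAtlas 𝓘(ℝ, E) 1 M)
    {S : Set M} {Y : ∀ x : M, TangentSpace 𝓘(ℝ, E) x} (hY : ContinuousField S Y) (hp : p ∈ S)
    (hpχ : p ∈ χ.source) : ContinuousWithinAt (fun q => chartDeriv χ q (Y q)) S p := by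
  have h1 : ContinuousOn (tangentMapWithin 𝓘(ℝ, E) 𝓘(ℝ, E) χ χ.source)
      (π E (TangentSpace 𝓘(ℝ, E)) ⁻¹' χ.source) :=
    (contMDiffOn_of_mem_maximalAtlas hχ).continuousOn_tangentMapWithin le_rfl
      χ.open_source.uniqueMDiffOn
  have h2 : ContinuousAt (tangentMapWithin 𝓘(ℝ, E) 𝓘(ℝ, E) χ χ.source)
      (⟨p, Y p⟩ : TangentBundle 𝓘(ℝ, E) M) := by
    refine h1.continuousAt (IsOpen.mem_nhds ?_ hpχ)
    exact χ.open_source.preimage (FiberBundle.continuous_proj E (TangentSpace 𝓘(ℝ, E)))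
  have h3 := (tangentBundleModelSpaceHomeomorph 𝓘(ℝ, E)).continuous.continuousAt.comp h2
  have h4 := (continuous_snd (X := E) (Y := E)).continuousAt.comp_continuousWithinAt
    (ContinuousAt.comp_continuousWithinAt
      (f := fun x => (⟨x, Y x⟩ : TangentBundle 𝓘(ℝ, E) M)) h3 (hY p hp))
  refine h4.congr_of_eventuallyEq ?_ ?_
  · filter_upwards [mem_nhdsWithin_of_mem_nhds (χ.open_source.mem_nhds hpχ)] with q hq
    simp only [Function.comp, tangentBundleModelSpaceHomeomorph_coe, tangentMapWithin,
      mfderivWithin_of_isOpen χ.open_source hq]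
    rfl
  · simp only [Function.comp, tangentBundleModelSpaceHomeomorph_coe, tangentMapWithin,
      mfderivWithin_of_isOpen χ.open_source hpχ]
    rfl

variable [RiemannianBundle (fun x : M => TangentSpace 𝓘(ℝ, E) x)]
  [IsContinuousRiemannianBundle E (fun x : M => TangentSpace 𝓘(ℝ, E) x)]

/-- The continuous metric bounds the trivialization, which is the derivative of the preferred chart
at `p`; a C¹ change of charts passes from that chart to `χ`. -/
theorem eventually_norm_chartDeriv_le (hχ : χ ∈ IsManifold.maximalAtlas 𝓘(ℝ, E) 1 M)
    (hp : p ∈ χ.source) :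
    ∃ K : ℝ, 0 < K ∧ ∀ᶠ q in 𝓝 p, ∀ u : TangentSpace 𝓘(ℝ, E) q, ‖chartDeriv χ q u‖ ≤ K * ‖u‖ := by
  obtain ⟨C, hC, hC'⟩ := eventually_norm_trivializationAt_lt E
    (fun x : M => TangentSpace 𝓘(ℝ, E) x) p
  have hc : chartAt E p ∈ IsManifold.maximalAtlas 𝓘(ℝ, E) 1 M :=
    IsManifold.chart_mem_maximalAtlas p
  have hcd : ContDiffAt ℝ 1 (χ ∘ id ∘ (chartAt E p).symm) (chartAt E p p) :=
    contDiffAt_chart_comp hc hχ contMDiffAt_id (mem_chart_source E p) hp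
  have hcont := (hcd.continuousAt_fderiv (by simp)).comp
    ((chartAt E p).continuousAt (mem_chart_source E p))
  have hb := hcont.norm.eventually (gt_mem_nhds (lt_add_one _))
  refine ⟨(‖fderiv ℝ (χ ∘ id ∘ (chartAt E p).symm) (chartAt E p p)‖ + 1) * C, by positivity, ?_⟩
  filter_upwards [hb, hC', χ.open_source.mem_nhds hp, chart_source_mem_nhds E p]
    with q hq hqC hqχ hqc u
  have h1 := fderiv_comp_chartDeriv hc hχ (h := id) mdifferentiableAt_id hqc hqχ u
  rw [mfderiv_id] at h1
  have h2 : ‖chartDeriv (chartAt E p) q u‖ ≤ C * ‖u‖ := by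
    have := TangentBundle.continuousLinearMapAt_trivializationAt (I := 𝓘(ℝ, E)) hqc
    have h3 := ContinuousLinearMap.le_of_opNorm_le _ hqC.le u
    rw [this] at h3
    exact h3
  calc ‖chartDeriv χ q u‖
      = ‖fderiv ℝ (χ ∘ id ∘ (chartAt E p).symm) (chartAt E p q)
          (chartDeriv (chartAt E p) q u)‖ := by rw [h1]; rfl
    _ ≤ ‖fderiv ℝ (χ ∘ id ∘ (chartAt E p).symm) (chartAt E p q)‖ *
          ‖chartDeriv (chartAt E p) q u‖ := ContinuousLinearMap.le_opNorm _ _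
    _ ≤ (‖fderiv ℝ (χ ∘ id ∘ (chartAt E p).symm) (chartAt E p p)‖ + 1) * (C * ‖u‖) := by
        gcongr
        exact hq.le
    _ = _ := by ring

end ChartDerivative

/-! ### Riemannian distance against distance in a chart. -/

section Lipschitz

variable {E : Type*} [NormedAddCommGroup E] [NormedSpace ℝ E]
  {M : Type*} [EMetricSpace M] [ChartedSpace E M] [IsManifold 𝓘(ℝ, E) 1 M]
  [RiemannianBundle (fun x : M => TangentSpace 𝓘(ℝ, E) x)]
  [IsContinuousRiemannianBundle E (fun x : M => TangentSpace 𝓘(ℝ, E) x)]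
  [IsRiemannianManifold 𝓘(ℝ, E) M]
  {χ : OpenPartialHomeomorph M E} {p : M}

/-- Charts are locally Lipschitz for the Riemannian distance. -/
theorem eventually_norm_chart_sub_le (hχ : χ ∈ IsManifold.maximalAtlas 𝓘(ℝ, E) 1 M)
    (hp : p ∈ χ.source) :
    ∃ U ∈ 𝓝 p, ∀ᶠ K : ℝ in atTop, ∀ x ∈ U, ∀ y, edist y x < ENNReal.ofReal K⁻¹ →
      y ∈ χ.source ∧ ‖χ y - χ x‖ ≤ K * (edist y x).toReal := by
  obtain ⟨C, hC, hC'⟩ := eventually_norm_chartDeriv_le hχ hp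
  obtain ⟨δ, hδ, hball⟩ := EMetric.mem_nhds_iff.1 (inter_mem (χ.open_source.mem_nhds hp) hC')
  have hlim : Tendsto (fun K : ℝ => ENNReal.ofReal K⁻¹) atTop (𝓝 0) := by
    simpa using ENNReal.tendsto_ofReal tendsto_inv_atTop_zero
  -- A path that starts within δ/2 of p and is shorter than δ/2 stays in the δ-ball, where the chart
  -- is defined and its derivative is bounded.
  refine ⟨Metric.eball p (δ / 2), Metric.eball_mem_nhds _ (ENNReal.half_pos hδ.ne'), ?_⟩
  filter_upwards [eventually_ge_atTop C, hlim.eventually (gt_mem_nhds (ENNReal.half_pos hδ.ne'))]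
    with K hK hKδ x hx y hxy
  -- The distance is an infimum of lengths that need not be attained, so the bound is proved for
  -- every larger `R`, and `R` then decreases to the distance.
  have key : ∀ R : ℝ≥0∞, edist x y < R → R ≤ ENNReal.ofReal K⁻¹ →
      y ∈ χ.source ∧ ‖χ y - χ x‖ₑ ≤ ENNReal.ofReal C * R := by
    intro R hR hRK
    rw [IsRiemannianManifold.out (I := 𝓘(ℝ, E)) x y] at hR
    obtain ⟨γ, hγx, hγy, γ_smooth, hγ, -⟩ :=
      exists_lt_locally_constant_of_riemannianEDist_lt hR zero_lt_one
    have hmem : ∀ t ∈ Icc (0 : ℝ) 1, γ t ∈ χ.source ∩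
        {q | ∀ u : TangentSpace 𝓘(ℝ, E) q, ‖chartDeriv χ q u‖ ≤ C * ‖u‖} := by
      intro t ht
      apply hball
      have h1 : edist x (γ t) ≤ Manifold.pathELength 𝓘(ℝ, E) γ 0 t := by
        rw [IsRiemannianManifold.out (I := 𝓘(ℝ, E)) x (γ t)]
        exact Manifold.riemannianEDist_le_pathELength γ_smooth.contMDiffOn hγx rfl ht.1
      have h2 : edist x (γ t) < δ / 2 :=
        (h1.trans (Manifold.pathELength_mono le_rfl ht.2)).trans_lt
          (hγ.trans_le (hRK.trans hKδ.le))
      rw [Metric.mem_eball]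
      calc edist (γ t) p ≤ edist (γ t) x + edist x p := edist_triangle _ _ _
        _ < δ / 2 + δ / 2 := ENNReal.add_lt_add (by rwa [edist_comm]) hx
        _ = δ := ENNReal.add_halves δ
    refine ⟨hγy ▸ (hmem 1 (by simp)).1, ?_⟩
    let γ' := χ ∘ γ
    have hC1 : ContMDiffOn 𝓘(ℝ, ℝ) 𝓘(ℝ, E) 1 γ' (Icc 0 1) :=
      (contMDiffOn_of_mem_maximalAtlas hχ).comp (t := χ.source)
        γ_smooth.contMDiffOn (fun t ht => (hmem t ht).1)
    calc ‖χ y - χ x‖ₑ = ‖γ' 1 - γ' 0‖ₑ := by simp [γ', hγx, hγy]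
      _ ≤ ∫⁻ t in Icc 0 1, ‖derivWithin γ' (Icc 0 1) t‖ₑ := by
        apply enorm_sub_le_lintegral_derivWithin_Icc_of_contDiffOn_Icc _ zero_le_one
        rwa [← contMDiffOn_iff_contDiffOn]
      _ ≤ ∫⁻ t in Icc 0 1, ENNReal.ofReal C *
          ‖mfderivWithin 𝓘(ℝ, ℝ) 𝓘(ℝ, E) γ (Icc 0 1) t 1‖ₑ := by
        apply MeasureTheory.setLIntegral_mono' measurableSet_Icc (fun t ht => ?_)
        have h1 : mfderivWithin 𝓘(ℝ, ℝ) 𝓘(ℝ, E) γ' (Icc 0 1) t =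
            (mfderiv 𝓘(ℝ, E) 𝓘(ℝ, E) χ (γ t)) ∘L
              (mfderivWithin 𝓘(ℝ, ℝ) 𝓘(ℝ, E) γ (Icc 0 1) t) := by
          apply mfderiv_comp_mfderivWithin
          · exact mdifferentiableAt_of_mem_maximalAtlas hχ (hmem t ht).1
          · exact (γ_smooth.mdifferentiable one_ne_zero).mdifferentiableOn _ ht
          · rw [uniqueMDiffWithinAt_iff_uniqueDiffWithinAt]
            exact uniqueDiffOn_Icc zero_lt_one _ ht
        have h2 : derivWithin γ' (Icc 0 1) t = chartDeriv χ (γ t)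
            (mfderivWithin 𝓘(ℝ, ℝ) 𝓘(ℝ, E) γ (Icc 0 1) t 1) := by
          rw [← fderivWithin_derivWithin, ← mfderivWithin_eq_fderivWithin]
          exact congrArg (fun L => L 1) h1
        have h3 := (hmem t ht).2 (mfderivWithin 𝓘(ℝ, ℝ) 𝓘(ℝ, E) γ (Icc 0 1) t 1)
        rw [h2, ← ofReal_norm, ← ofReal_norm, ← ENNReal.ofReal_mul hC.le]
        exact ENNReal.ofReal_le_ofReal h3
      _ = ENNReal.ofReal C * Manifold.pathELength 𝓘(ℝ, E) γ 0 1 := by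
        rw [MeasureTheory.lintegral_const_mul' _ _ ENNReal.ofReal_ne_top,
          Manifold.pathELength_eq_lintegral_mfderivWithin_Icc]
      _ ≤ ENNReal.ofReal C * R := by gcongr
  rw [edist_comm] at hxy ⊢
  refine ⟨(key _ hxy le_rfl).1, ?_⟩
  have hle : ‖χ y - χ x‖ₑ ≤ ENNReal.ofReal C * edist x y := by
    refine le_of_forall_gt fun b hb => ?_
    obtain ⟨R, hR, hRb⟩ : ∃ R, edist x y < R ∧ ENNReal.ofReal C * R < b := by
      rw [mul_comm] at hb
      have hC0 : ENNReal.ofReal C ≠ 0 := by simpa using hC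
      obtain ⟨R, h1, h2⟩ := exists_between
        ((ENNReal.lt_div_iff_mul_lt (Or.inl hC0) (Or.inl ENNReal.ofReal_ne_top)).2 hb)
      refine ⟨R, h1, ?_⟩
      rw [mul_comm]
      exact (ENNReal.lt_div_iff_mul_lt (Or.inl hC0) (Or.inl ENNReal.ofReal_ne_top)).1 h2
    have h1 := (key (min R (ENNReal.ofReal K⁻¹)) (lt_min hR hxy) (min_le_right _ _)).2
    exact (h1.trans (by gcongr; exact min_le_left _ _)).trans_lt hRb
  have hfin : edist x y ≠ ⊤ := (hxy.trans ENNReal.ofReal_lt_top).ne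
  rw [← ofReal_norm, ← ENNReal.ofReal_toReal hfin, ← ENNReal.ofReal_mul hC.le] at hle
  have := (ENNReal.ofReal_le_ofReal_iff (by positivity)).1 hle
  exact this.trans (by gcongr)

end Lipschitz

/-! ### Extending a chart-supported diffeomorphism by the identity. -/

section ChartConj

/-- If `e w` lies off `S`, it is a fixed point, and injectivity gives `e w = w`. -/
theorem mapsTo_of_eq_off {X : Type*} {S T : Set X} {e : X ≃ X} (he : ∀ w ∉ S, e w = w)
    (hS : S ⊆ T) : MapsTo e T T := by
  intro w hw
  by_cases h : e w ∈ S
  · exact hS h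
  · rwa [e.injective (he _ h)]

variable {E : Type*} [NormedAddCommGroup E] {M : Type*} [TopologicalSpace M]

open Classical in
/-- The self-map of `M` that is `τ` in the chart `χ` and the identity off the chart domain. -/
def chartConj (χ : OpenPartialHomeomorph M E) (τ : E → E) (x : M) : M :=
  if x ∈ χ.source then χ.symm (τ (χ x)) else x

variable {χ : OpenPartialHomeomorph M E} {τ : E → E} {S : Set E} {x : M}

theorem chartConj_of_mem (hx : x ∈ χ.source) : chartConj χ τ x = χ.symm (τ (χ x)) := if_pos hx

theorem chartConj_of_notMem (hτ : ∀ w ∉ S, τ w = w) (hx : x ∉ χ.symm '' S) :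
    chartConj χ τ x = x := by
  by_cases h : x ∈ χ.source
  · rw [chartConj_of_mem h, hτ, χ.left_inv h]
    exact fun hS' => hx ⟨χ x, hS', χ.left_inv h⟩
  · exact if_neg h

theorem isCompact_symm_image (hc : IsCompact S) (hS : S ⊆ χ.target) : IsCompact (χ.symm '' S) :=
  hc.image_of_continuousOn (χ.continuousOn_symm.mono hS)

variable [NormedSpace ℝ E] [ChartedSpace E M]

/-- Two open sets cover `M`: the chart domain, and the complement of the image of `S`, which is
closed because it is compact in a Hausdorff space. On the second one the map is the identity. -/
theorem contMDiff_chartConj [T2Space M] {n : ℕ∞ω}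
    (hχ : χ ∈ IsManifold.maximalAtlas 𝓘(ℝ, E) n M) (hτn : ContDiff ℝ n τ)
    (hτ : ∀ w ∉ S, τ w = w) (hc : IsCompact S) (hS : S ⊆ χ.target)
    (hm : MapsTo τ χ.target χ.target) : ContMDiff 𝓘(ℝ, E) 𝓘(ℝ, E) n (chartConj χ τ) := by
  intro x
  by_cases hx : x ∈ χ.source
  · have h1 : ContMDiffAt 𝓘(ℝ, E) 𝓘(ℝ, E) n χ x := contMDiffAt_of_mem_maximalAtlas hχ hx
    have h2 : ContMDiffAt 𝓘(ℝ, E) 𝓘(ℝ, E) n τ (χ x) := hτn.contMDiff.contMDiffAt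
    have h3 : ContMDiffAt 𝓘(ℝ, E) 𝓘(ℝ, E) n χ.symm (τ (χ x)) :=
      contMDiffAt_symm_of_mem_maximalAtlas hχ (hm (χ.map_source hx))
    refine ((h3.comp (χ x) h2).comp x h1).congr_of_eventuallyEq ?_
    filter_upwards [χ.open_source.mem_nhds hx] with y hy
    exact chartConj_of_mem hy
  · have hx' : x ∉ χ.symm '' S := by
      rintro ⟨w, hw, rfl⟩
      exact hx (χ.map_target (hS hw))
    refine contMDiffAt_id.congr_of_eventuallyEq ?_
    filter_upwards [(isCompact_symm_image hc hS).isClosed.isOpen_compl.mem_nhds hx'] with y hy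
    exact chartConj_of_notMem hτ hy

/-- A diffeomorphism of the model space supported in a chart induces a diffeomorphism of `M`. -/
theorem exists_diffeomorph_chartConj [T2Space M] {n : ℕ∞ω}
    (hχ : χ ∈ IsManifold.maximalAtlas 𝓘(ℝ, E) n M) {e : E ≃ E} (he : ContDiff ℝ n e)
    (he' : ContDiff ℝ n e.symm) (hfix : ∀ w ∉ S, e w = w) (hc : IsCompact S) (hS : S ⊆ χ.target) :
    ∃ Φ : M ≃ₘ^n⟮𝓘(ℝ, E), 𝓘(ℝ, E)⟯ M, ⇑Φ = chartConj χ e := by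
  have hfix' : ∀ w ∉ S, e.symm w = w := fun w hw => by
    rw [Equiv.symm_apply_eq, hfix w hw]
  have hinv : ∀ e : E ≃ E, (∀ w ∉ S, e w = w) → ∀ x,
      chartConj χ e.symm (chartConj χ e x) = x := by
    intro e he x
    by_cases hx : x ∈ χ.source
    · have h1 := mapsTo_of_eq_off he hS (χ.map_source hx)
      rw [chartConj_of_mem hx, chartConj_of_mem (χ.map_target h1), χ.right_inv h1,
        e.symm_apply_apply, χ.left_inv hx]
    · simp only [chartConj, hx, if_false]
  exact ⟨{ toFun := chartConj χ e
           invFun := chartConj χ e.symm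
           left_inv := hinv e hfix
           right_inv := hinv e.symm hfix'
           contMDiff_toFun := contMDiff_chartConj hχ he hfix hc hS (mapsTo_of_eq_off hfix hS)
           contMDiff_invFun :=
            contMDiff_chartConj hχ he' hfix' hc hS (mapsTo_of_eq_off hfix' hS) }, rfl⟩

end ChartConj

/-! ### First derivative of the perturbed map in ε and the base point. -/

section Expansion

variable {E : Type*} [NormedAddCommGroup E] [NormedSpace ℝ E]
  {M : Type*} [TopologicalSpace M]
  {χ χ₁ χ₂ : OpenPartialHomeomorph M E} {ρ : E → ℝ} {v : E} {r : ℕ}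
  {f : M → M} {p : M}

/-- The family of perturbations of `f` by shifts in the chart `χ`, read in two charts. -/
def shiftRep (χ χ₁ χ₂ : OpenPartialHomeomorph M E) (ρ : E → ℝ) (v : E) (f : M → M)
    (q : ℝ × E) : E :=
  χ₂ (chartConj χ (bumpShift ρ v q.1) (f (χ₁.symm q.2)))

theorem shiftRep_eventuallyEq_of_mem (hf : ContinuousAt f p) (hp : p ∈ χ₁.source)
    (hfp : f p ∈ χ.source) :
    shiftRep χ χ₁ χ₂ ρ v f =ᶠ[𝓝 (0, χ₁ p)] (χ₂ ∘ id ∘ χ.symm) ∘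
      Function.uncurry (bumpShift ρ v) ∘ Prod.map id (χ ∘ f ∘ χ₁.symm) := by
  have h1 : ContinuousAt (f ∘ χ₁.symm) (χ₁ p) := by
    refine ContinuousAt.comp ?_ (χ₁.continuousAt_symm (χ₁.map_source hp))
    rwa [χ₁.left_inv hp]
  have h2 : ∀ᶠ w in 𝓝 (χ₁ p), f (χ₁.symm w) ∈ χ.source :=
    h1.eventually (χ.open_source.mem_nhds (by simpa [χ₁.left_inv hp]))
  filter_upwards [(continuousAt_snd (p := ((0 : ℝ), χ₁ p))).eventually h2] with q hq
  simp only [shiftRep, chartConj_of_mem hq]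
  rfl

variable [T2Space M]

theorem shiftRep_eventuallyEq_of_notMem (hf : ContinuousAt f p) (hp : p ∈ χ₁.source)
    (hc : HasCompactSupport ρ) (hS : tsupport ρ ⊆ χ.target) (hfp : f p ∉ χ.symm '' tsupport ρ) :
    shiftRep χ χ₁ χ₂ ρ v f =ᶠ[𝓝 (0, χ₁ p)] (χ₂ ∘ f ∘ χ₁.symm) ∘ Prod.snd := by
  have h1 : ContinuousAt (f ∘ χ₁.symm) (χ₁ p) := by
    refine ContinuousAt.comp ?_ (χ₁.continuousAt_symm (χ₁.map_source hp))
    rwa [χ₁.left_inv hp]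
  have h2 : ∀ᶠ w in 𝓝 (χ₁ p), f (χ₁.symm w) ∈ (χ.symm '' tsupport ρ)ᶜ :=
    h1.eventually ((isCompact_symm_image hc hS).isClosed.isOpen_compl.mem_nhds
      (by simpa [χ₁.left_inv hp] using hfp))
  filter_upwards [(continuousAt_snd (p := ((0 : ℝ), χ₁ p))).eventually h2] with q hq
  simp [shiftRep, chartConj_of_notMem (fun w hw => bumpShift_of_notMem hw) hq]

variable [ChartedSpace E M]

/-- Either the shift is read in `χ` as a composition, or `f p` is off the compact support and ε has
no effect nearby. With r ≥ 2 this smoothness suffices for the quadratic Taylor remainder. -/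
theorem contDiffAt_shiftRep (hχ : χ ∈ IsManifold.maximalAtlas 𝓘(ℝ, E) r M)
    (hχ₁ : χ₁ ∈ IsManifold.maximalAtlas 𝓘(ℝ, E) r M)
    (hχ₂ : χ₂ ∈ IsManifold.maximalAtlas 𝓘(ℝ, E) r M) (hρ : ContDiff ℝ ∞ ρ)
    (hc : HasCompactSupport ρ) (hS : tsupport ρ ⊆ χ.target)
    (hf : ContMDiffAt 𝓘(ℝ, E) 𝓘(ℝ, E) r f p) (hp : p ∈ χ₁.source) (hfp : f p ∈ χ₂.source) :
    ContDiffAt ℝ r (shiftRep χ χ₁ χ₂ ρ v f) (0, χ₁ p) := by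
  by_cases h : f p ∈ χ.source
  · refine ContDiffAt.congr_of_eventuallyEq ?_
      (shiftRep_eventuallyEq_of_mem hf.continuousAt hp h)
    have e : Function.uncurry (bumpShift ρ v) (Prod.map id (χ ∘ f ∘ χ₁.symm) ((0 : ℝ), χ₁ p)) =
        χ (f p) := by
      simp [Function.uncurry, bumpShift, χ₁.left_inv hp]
    refine ContDiffAt.comp _ (g := χ₂ ∘ id ∘ χ.symm) ?_ (ContDiffAt.comp _ ?_ ?_)
    · simp only [Function.comp_apply] at e ⊢
      rw [e]
      exact contDiffAt_chart_comp hχ hχ₂ contMDiffAt_id h hfp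
    · exact (contDiff_bumpShift (hρ.of_le (by exact_mod_cast le_top))).contDiffAt
    · exact contDiffAt_id.prodMap (contDiffAt_chart_comp hχ₁ hχ hf hp h)
  · refine ContDiffAt.congr_of_eventuallyEq ?_
      (shiftRep_eventuallyEq_of_notMem hf.continuousAt hp hc hS ?_)
    · exact ContDiffAt.comp _ (g := χ₂ ∘ f ∘ χ₁.symm) (contDiffAt_chart_comp hχ₁ hχ₂ hf hp hfp)
        contDiffAt_snd
    · rintro ⟨w, hw, hw'⟩
      exact h (hw' ▸ χ.map_target (hS hw))

/-- The derivative of the perturbed map, in terms of the vector field `V` that directs the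
perturbation. -/
theorem fderiv_shiftRep (hr : 1 ≤ r) (hχ : χ ∈ IsManifold.maximalAtlas 𝓘(ℝ, E) r M)
    (hχ₁ : χ₁ ∈ IsManifold.maximalAtlas 𝓘(ℝ, E) r M)
    (hχ₂ : χ₂ ∈ IsManifold.maximalAtlas 𝓘(ℝ, E) r M) (hρ : ContDiff ℝ ∞ ρ)
    (hc : HasCompactSupport ρ) (hS : tsupport ρ ⊆ χ.target)
    (hf : ContMDiffAt 𝓘(ℝ, E) 𝓘(ℝ, E) r f p) (hp : p ∈ χ₁.source) (hfp : f p ∈ χ₂.source)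
    {V : ∀ q : M, TangentSpace 𝓘(ℝ, E) q}
    (hV : ∀ q ∈ χ.source, chartDeriv χ q (V q) = ρ (χ q) • v) (hV' : ∀ q ∉ χ.source, V q = 0)
    (s : ℝ) (u : TangentSpace 𝓘(ℝ, E) p) :
    fderiv ℝ (shiftRep χ χ₁ χ₂ ρ v f) (0, χ₁ p) (s, chartDeriv χ₁ p u) =
      chartDeriv χ₂ (f p) (mfderiv 𝓘(ℝ, E) 𝓘(ℝ, E) f p u + s • V (f p)) := by
  have hr' : (1 : ℕ∞ω) ≤ r := by exact_mod_cast hr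
  have a := IsManifold.maximalAtlas_subset_of_le hr' hχ
  have a₁ := IsManifold.maximalAtlas_subset_of_le hr' hχ₁
  have a₂ := IsManifold.maximalAtlas_subset_of_le hr' hχ₂
  have hf' : MDifferentiableAt 𝓘(ℝ, E) 𝓘(ℝ, E) f p := hf.mdifferentiableAt (by positivity)
  by_cases h : f p ∈ χ.source
  · rw [(shiftRep_eventuallyEq_of_mem hf.continuousAt hp h).fderiv_eq]
    have e : Function.uncurry (bumpShift ρ v) (Prod.map id (χ ∘ f ∘ χ₁.symm) ((0 : ℝ), χ₁ p)) =
        χ (f p) := by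
      simp [Function.uncurry, bumpShift, χ₁.left_inv hp]
    have d1 : HasFDerivAt (χ ∘ f ∘ χ₁.symm) (fderiv ℝ (χ ∘ f ∘ χ₁.symm) (χ₁ p)) (χ₁ p) :=
      ((contDiffAt_chart_comp hχ₁ hχ hf hp h).differentiableAt (by positivity)).hasFDerivAt
    have d2 : HasFDerivAt (Prod.map (id : ℝ → ℝ) (χ ∘ f ∘ χ₁.symm))
        ((ContinuousLinearMap.id ℝ ℝ).prodMap (fderiv ℝ (χ ∘ f ∘ χ₁.symm) (χ₁ p)))
        ((0 : ℝ), χ₁ p) :=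
      HasFDerivAt.prodMap _ (hasFDerivAt_id (0 : ℝ)) d1
    have e2 : Prod.map (id : ℝ → ℝ) (χ ∘ f ∘ χ₁.symm) ((0 : ℝ), χ₁ p) = (0, χ (f p)) := by
      simp [χ₁.left_inv hp]
    have d3 := hasFDerivAt_bumpShift (v := v) (hρ.differentiable (by simp)) (χ (f p))
    rw [← e2] at d3
    have d4 : HasFDerivAt (χ₂ ∘ id ∘ χ.symm) (fderiv ℝ (χ₂ ∘ id ∘ χ.symm) (χ (f p))) (χ (f p)) :=
      ((contDiffAt_chart_comp hχ hχ₂ contMDiffAt_id h hfp).differentiableAt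
        (by positivity)).hasFDerivAt
    have d5 := d3.comp _ d2
    have d6 := HasFDerivAt.comp (g := χ₂ ∘ id ∘ χ.symm) ((0 : ℝ), χ₁ p)
      (by
        simp only [Function.comp_apply] at e ⊢
        rw [e]; exact d4) d5
    rw [d6.fderiv]
    have k1 := fderiv_comp_chartDeriv a₁ a hf' hp h u
    have k2 := fderiv_comp_chartDeriv a a₂ mdifferentiableAt_id h hfp
      (mfderiv 𝓘(ℝ, E) 𝓘(ℝ, E) f p u + s • V (f p))
    rw [mfderiv_id] at k2
    refine Eq.trans ?_ k2
    simp only [ContinuousLinearMap.comp_apply]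
    congr 1
    rw [map_add, map_smul, hV _ h, ← k1]
    simp
  · rw [(shiftRep_eventuallyEq_of_notMem hf.continuousAt hp hc hS ?_).fderiv_eq]
    · have d4 : HasFDerivAt (χ₂ ∘ f ∘ χ₁.symm) (fderiv ℝ (χ₂ ∘ f ∘ χ₁.symm) (χ₁ p)) (χ₁ p) :=
        ((contDiffAt_chart_comp hχ₁ hχ₂ hf hp hfp).differentiableAt (by positivity)).hasFDerivAt
      have d5 := HasFDerivAt.comp (g := χ₂ ∘ f ∘ χ₁.symm) ((0 : ℝ), χ₁ p) d4
        (hasFDerivAt_snd (𝕜 := ℝ) (p := ((0 : ℝ), χ₁ p)))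
      rw [d5.fderiv, hV' _ h, smul_zero, add_zero]
      exact fderiv_comp_chartDeriv a₁ a₂ hf' hp hfp u
    · rintro ⟨w, hw, hw'⟩
      exact h (hw' ▸ χ.map_target (hS hw))

end Expansion

/-! ### The perturbation is O(ε) in the C^r distance. -/

section CrEstimates

/-- If a family `Δ ε` is `C^r`-small with `ε`, so is `Δ ε ∘ h`. -/
theorem eventually_iteratedFDeriv_comp_le {E F G : Type*} [NormedAddCommGroup E] [NormedSpace ℝ E]
    [NormedAddCommGroup F] [NormedSpace ℝ F] [NormedAddCommGroup G] [NormedSpace ℝ G]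
    {Δ : ℝ → F → G} {h : E → F} {y₀ : E} {r : ℕ}
    (hΔ : ContDiffAt ℝ ((r + 1 : ℕ) : ℕ∞ω) (Function.uncurry Δ) (0, h y₀)) (hΔ0 : Δ 0 = 0)
    (hh : ContDiffAt ℝ r h y₀) :
    ∃ s ∈ 𝓝 y₀, ∀ᶠ K : ℝ in atTop, ∀ y ∈ s, ∀ ε, |ε| < K⁻¹ → ∀ k ≤ r,
      ContDiffAt ℝ r (Δ ε ∘ h) y ∧ ‖iteratedFDeriv ℝ k (Δ ε ∘ h) y‖ ≤ K * |ε| := by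
  have hev := (hΔ.eventually (by simp))
  obtain ⟨K₁, ⟨hK₁, hK₁b⟩, hK₁0⟩ := (((eventually_iteratedFDeriv_le hΔ hΔ0).and
    (eventually_atTop_ball_subset hev)).and (eventually_gt_atTop 0)).exists
  have hcd : ∀ ε, |ε| < K₁⁻¹ → ∀ w ∈ Metric.ball (h y₀) K₁⁻¹, ContDiffAt ℝ r (Δ ε) w := by
    intro ε hε w hw
    have h1 : ((ε, w) : ℝ × F) ∈ Metric.ball ((0 : ℝ), h y₀) K₁⁻¹ := by
      rw [← ball_prod_same]
      exact ⟨by simpa using hε, hw⟩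
    have h2 : ContDiffAt ℝ ((r + 1 : ℕ) : ℕ∞ω) (Function.uncurry Δ) (ε, w) := hK₁b h1
    exact (h2.of_le (by exact_mod_cast r.le_succ)).comp w (f := fun w => (ε, w)) (by fun_prop)
  have hD : ∃ D : ℝ, 1 ≤ D ∧ ∀ᶠ y in 𝓝 y₀, ∀ k ≤ r, ‖iteratedFDeriv ℝ k h y‖ ≤ D := by
    have h1 : ∀ k ∈ Iic r, ∀ᶠ D : ℝ in atTop, ∀ᶠ y in 𝓝 y₀, ‖iteratedFDeriv ℝ k h y‖ ≤ D := by
      intro k hk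
      filter_upwards [eventually_ge_atTop (‖iteratedFDeriv ℝ k h y₀‖ + 1)] with D hDk
      have h2 := (hh.continuousAt_iteratedFDeriv (by exact_mod_cast hk)).norm.eventually
        (gt_mem_nhds (lt_add_one _))
      exact h2.mono fun y hy => hy.le.trans hDk
    obtain ⟨D, hD1, hD⟩ := (((eventually_all_finite (finite_Iic r)).2 h1).and
      (eventually_ge_atTop 1)).exists
    exact ⟨D, hD, (eventually_all_finite (finite_Iic r)).2 hD1⟩
  obtain ⟨D, hD1, hD⟩ := hD
  obtain ⟨s, hs, hso, hys⟩ := mem_nhds_iff.1 (inter_mem hD (inter_mem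
    (hh.eventually (by simp)) (hh.continuousAt.preimage_mem_nhds
      (Metric.ball_mem_nhds (h y₀) (inv_pos.2 hK₁0)))))
  refine ⟨s, hso.mem_nhds hys, ?_⟩
  -- The constant is that of the bound k! C D^k for derivatives of a composition, with C = K₁|ε|; D
  -- ≥ 1 lets `D` bound all orders through its powers.
  filter_upwards [eventually_ge_atTop K₁, eventually_ge_atTop (r.factorial * K₁ * D ^ r)]
    with K hKK₁ hK y hy ε hε k hk
  have hε' : |ε| < K₁⁻¹ := hε.trans_le (inv_anti₀ hK₁0 hKK₁)
  have c1 : ContDiffOn ℝ r (Δ ε) (Metric.ball (h y₀) K₁⁻¹) :=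
    fun w hw => (hcd ε hε' w hw).contDiffWithinAt
  have c2 : ContDiffOn ℝ r h s := fun w hw => ContDiffAt.contDiffWithinAt (hs hw).2.1
  have hm : MapsTo h s (Metric.ball (h y₀) K₁⁻¹) := fun w hw => (hs hw).2.2
  refine ⟨(c1.comp c2 hm).contDiffAt (hso.mem_nhds hy), ?_⟩
  rw [← iteratedFDerivWithin_of_isOpen k hso hy]
  refine (norm_iteratedFDerivWithin_comp_le c1 c2 (by exact_mod_cast hk)
    Metric.isOpen_ball.uniqueDiffOn hso.uniqueDiffOn hm hy (C := K₁ * |ε|) (D := D) ?_ ?_).trans ?_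
  · intro i hi
    rw [iteratedFDerivWithin_of_isOpen i Metric.isOpen_ball (hm hy)]
    exact hK₁ ε hε' _ (hm hy) i (hi.trans hk)
  · intro i hi hik
    rw [iteratedFDerivWithin_of_isOpen i hso hy]
    exact ((hs hy).1 i (hik.trans hk)).trans (le_self_pow₀ hD1 (by lia))
  · calc (k.factorial : ℝ) * (K₁ * |ε|) * D ^ k ≤ r.factorial * (K₁ * |ε|) * D ^ r := by
          gcongr
      _ = r.factorial * K₁ * D ^ r * |ε| := by ring
      _ ≤ K * |ε| := by gcongr

variable {E : Type*} [NormedAddCommGroup E] [NormedSpace ℝ E]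
  {M : Type*} [TopologicalSpace M] [T2Space M] [ChartedSpace E M]
  {χ χ₁ χ₂ : OpenPartialHomeomorph M E} {ρ : E → ℝ} {v : E} {r : ℕ} {f : M → M} {p : M}

/-- The perturbation read in two charts is `C^r`-close to the original map, near a point. -/
theorem eventually_edist_iteratedFDeriv_le (hχ : χ ∈ IsManifold.maximalAtlas 𝓘(ℝ, E) r M)
    (hχ₁ : χ₁ ∈ IsManifold.maximalAtlas 𝓘(ℝ, E) r M)
    (hχ₂ : χ₂ ∈ IsManifold.maximalAtlas 𝓘(ℝ, E) r M)
    (hcompat : χ.symm.trans χ₂ ∈ contDiffGroupoid ((r + 1 : ℕ) : ℕ∞ω) 𝓘(ℝ, E))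
    (hρ : ContDiff ℝ ∞ ρ) (hc : HasCompactSupport ρ) (hS : tsupport ρ ⊆ χ.target)
    (hf : ContMDiff 𝓘(ℝ, E) 𝓘(ℝ, E) r f) (hp : p ∈ χ₁.source) (hfp : f p ∈ χ₂.source) (c : ℝ≥0) :
    ∃ U ∈ 𝓝 p, ∀ᶠ K : ℝ in atTop, ∀ x ∈ U, ∀ ε, |ε| < K⁻¹ →
      chartConj χ (bumpShift ρ v ε) (f x) ∈ χ₂.source ∧ ∀ k ≤ r,
        (c : ℝ≥0∞) * edist (iteratedFDeriv ℝ k (χ₂ ∘ f ∘ χ₁.symm) (χ₁ x))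
          (iteratedFDeriv ℝ k (χ₂ ∘ (chartConj χ (bumpShift ρ v ε) ∘ f) ∘ χ₁.symm) (χ₁ x)) ≤
          ENNReal.ofReal (K * |ε|) := by
  by_cases h : f p ∈ χ.source
  · let W := (χ.symm.trans χ₂).source
    have hW : IsOpen W := (χ.symm.trans χ₂).open_source
    have hWmem : ∀ w, w ∈ W ↔ w ∈ χ.target ∧ χ.symm w ∈ χ₂.source := fun w => by
      simp [W, OpenPartialHomeomorph.trans_source]
    have hΨ : ContDiffOn ℝ ((r + 1 : ℕ) : ℕ∞ω) (χ₂ ∘ χ.symm) W :=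
      contMDiffOn_iff_contDiffOn.1 (contMDiffOn_of_mem_contDiffGroupoid hcompat)
    have hw₀ : χ (f p) ∈ W := (hWmem _).2 ⟨χ.map_source h, by rwa [χ.left_inv h]⟩
    -- The perturbed map in charts is the original plus `Δ ε ∘ hh`. All dependence on ε sits in `Δ`,
    -- which is jointly C^(r+1) by `hcompat`, while `f` enters only through `hh`, of class C^r.
    let Δ : ℝ → E → E := fun ε w => (χ₂ ∘ χ.symm) (bumpShift ρ v ε w) - (χ₂ ∘ χ.symm) w
    let hh : E → E := χ ∘ f ∘ χ₁.symm
    have hh0 : hh (χ₁ p) = χ (f p) := by simp [hh, χ₁.left_inv hp]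
    have hb : ContDiff ℝ ((r + 1 : ℕ) : ℕ∞ω) (Function.uncurry (bumpShift ρ v)) :=
      contDiff_bumpShift (hρ.of_le (by exact_mod_cast le_top))
    have hb0 : ∀ w, Function.uncurry (bumpShift ρ v) (0, w) = w := fun w => by
      simp [Function.uncurry, bumpShift]
    have hΔ : ContDiffAt ℝ ((r + 1 : ℕ) : ℕ∞ω) (Function.uncurry Δ) (0, hh (χ₁ p)) := by
      rw [hh0]
      have hΨw := hΨ.contDiffAt (hW.mem_nhds hw₀)
      refine ContDiffAt.sub ?_ ?_
      · refine ContDiffAt.comp (g := χ₂ ∘ χ.symm) (f := Function.uncurry (bumpShift ρ v)) _ ?_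
          hb.contDiffAt
        rw [hb0]
        exact hΨw
      · exact ContDiffAt.comp (g := χ₂ ∘ χ.symm) (f := Prod.snd) ((0 : ℝ), χ (f p)) hΨw
          contDiffAt_snd
    have hΔ0 : Δ 0 = 0 := by
      ext w
      simp [Δ, bumpShift]
    have hhc : ContDiffAt ℝ r hh (χ₁ p) := contDiffAt_chart_comp hχ₁ hχ hf.contMDiffAt hp h
    obtain ⟨s, hs, hK⟩ := eventually_iteratedFDeriv_comp_le hΔ hΔ0 hhc
    -- points where the perturbed map is read in the chart `χ`
    have hgood : ∀ᶠ q : ℝ × E in 𝓝 (0, χ (f p)), Function.uncurry (bumpShift ρ v) q ∈ W :=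
      hb.continuous.continuousAt.eventually (hW.mem_nhds (by rwa [hb0]))
    obtain ⟨K₁, hK₁, hK₁0⟩ := ((eventually_atTop_ball_subset hgood).and
      (eventually_gt_atTop 0)).exists
    let O : Set M := χ₁.source ∩ f ⁻¹' (χ.source ∩ χ ⁻¹' Metric.ball (χ (f p)) K₁⁻¹) ∩
      f ⁻¹' χ₂.source
    have hO : IsOpen O :=
      (χ₁.open_source.inter
        ((χ.isOpen_inter_preimage Metric.isOpen_ball).preimage hf.continuous)).inter
        (χ₂.open_source.preimage hf.continuous)
    have hpO : p ∈ O := ⟨⟨hp, h, Metric.mem_ball_self (inv_pos.2 hK₁0)⟩, hfp⟩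
    refine ⟨O ∩ (χ₁.source ∩ χ₁ ⁻¹' interior s), inter_mem (hO.mem_nhds hpO)
      ((χ₁.isOpen_inter_preimage isOpen_interior).mem_nhds
        ⟨hp, mem_interior_iff_mem_nhds.2 hs⟩), ?_⟩
    obtain ⟨K₂, hK₂, hK₂0⟩ := (hK.and (eventually_gt_atTop 0)).exists
    filter_upwards [eventually_ge_atTop K₁, eventually_ge_atTop K₂,
      eventually_ge_atTop (c * K₂)] with K h1 h2 h3 x hx ε hε
    have hε₁ : |ε| < K₁⁻¹ := hε.trans_le (inv_anti₀ hK₁0 h1)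
    have hread : ∀ y ∈ O, chartConj χ (bumpShift ρ v ε) (f y) =
        χ.symm (bumpShift ρ v ε (χ (f y))) ∧ bumpShift ρ v ε (χ (f y)) ∈ W := by
      intro y hy
      refine ⟨chartConj_of_mem hy.1.2.1, hK₁ (show (ε, χ (f y)) ∈ _ from ?_)⟩
      rw [← ball_prod_same]
      exact ⟨by simpa using hε₁, hy.1.2.2⟩
    refine ⟨?_, fun k hk => ?_⟩
    · rw [(hread x hx.1).1]
      exact ((hWmem _).1 (hread x hx.1).2).2
    · have hxs := hK₂ (χ₁ x) (interior_subset hx.2.2) ε (hε.trans_le (inv_anti₀ hK₂0 h2)) k hk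
      have heq : χ₂ ∘ (chartConj χ (bumpShift ρ v ε) ∘ f) ∘ χ₁.symm =ᶠ[𝓝 (χ₁ x)]
          χ₂ ∘ f ∘ χ₁.symm + Δ ε ∘ hh := by
        have : ∀ᶠ w in 𝓝 (χ₁ x), χ₁.symm w ∈ O :=
          (χ₁.continuousAt_symm (χ₁.map_source hx.2.1)).eventually
            (hO.mem_nhds (by rw [χ₁.left_inv hx.2.1]; exact hx.1))
        filter_upwards [this] with w hw
        simp [Δ, hh, (hread _ hw).1, χ.left_inv hw.1.2.1]
      have hk' : (k : ℕ∞ω) ≤ r := by exact_mod_cast hk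
      have hfr : ContDiffAt ℝ k (χ₂ ∘ f ∘ χ₁.symm) (χ₁ x) :=
        (contDiffAt_chart_comp hχ₁ hχ₂ hf.contMDiffAt hx.2.1 hx.1.2).of_le hk'
      rw [(heq.iteratedFDeriv ℝ k).eq_of_nhds, iteratedFDeriv_add_apply hfr (hxs.1.of_le hk'),
        edist_eq_enorm_sub, sub_add_cancel_left, enorm_neg, ← ofReal_norm,
        ← ENNReal.ofReal_coe_nnreal, ← ENNReal.ofReal_mul (NNReal.coe_nonneg c)]
      apply ENNReal.ofReal_le_ofReal
      calc (c : ℝ) * ‖iteratedFDeriv ℝ k (Δ ε ∘ hh) (χ₁ x)‖ ≤ c * (K₂ * |ε|) := by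
            gcongr
            exact hxs.2
        _ = c * K₂ * |ε| := by ring
        _ ≤ K * |ε| := by gcongr
  · have hfp' : f p ∉ χ.symm '' tsupport ρ := by
      rintro ⟨w, hw, hw'⟩
      exact h (hw' ▸ χ.map_target (hS hw))
    let O : Set M := χ₁.source ∩ f ⁻¹' (χ₂.source ∩ (χ.symm '' tsupport ρ)ᶜ)
    have hO : IsOpen O := χ₁.open_source.inter ((χ₂.open_source.inter
      (isCompact_symm_image hc hS).isClosed.isOpen_compl).preimage hf.continuous)
    refine ⟨O, hO.mem_nhds ⟨hp, hfp, hfp'⟩, ?_⟩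
    filter_upwards [eventually_ge_atTop 0] with K hK x hx ε hε
    have hread : ∀ y ∈ O, chartConj χ (bumpShift ρ v ε) (f y) = f y := fun y hy =>
      chartConj_of_notMem (fun w hw => bumpShift_of_notMem hw) hy.2.2
    refine ⟨by rw [hread x hx]; exact hx.2.1, fun k hk => ?_⟩
    have heq : χ₂ ∘ (chartConj χ (bumpShift ρ v ε) ∘ f) ∘ χ₁.symm =ᶠ[𝓝 (χ₁ x)]
        χ₂ ∘ f ∘ χ₁.symm := by
      have : ∀ᶠ w in 𝓝 (χ₁ x), χ₁.symm w ∈ O :=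
        (χ₁.continuousAt_symm (χ₁.map_source hx.1)).eventually
          (hO.mem_nhds (by rw [χ₁.left_inv hx.1]; exact hx))
      filter_upwards [this] with w hw
      simp [hread _ hw]
    rw [(heq.iteratedFDeriv ℝ k).eq_of_nhds, edist_self, mul_zero]
    exact zero_le

/-- The perturbations by shifts in a chart of the gauge are adapted to the gauge, and their
distance to the original map is of the order of the shift. -/
theorem CrGauge.eventually_crDist_chartConj_le (A : CrGauge E M r)
    {f : M ≃ₘ^r⟮𝓘(ℝ, E), 𝓘(ℝ, E)⟯ M} (hf : A.Adapted f) (j : ℕ) (hρ : ContDiff ℝ ∞ ρ)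
    (hc : HasCompactSupport ρ) (hS : tsupport ρ ⊆ (A.χ j).target) (v : E) :
    ∀ᶠ K : ℝ in atTop, ∀ ε, |ε| < K⁻¹ →
      A.Adapted (chartConj (A.χ j) (bumpShift ρ v ε) ∘ f) ∧
      A.crDist f (chartConj (A.χ j) (bumpShift ρ v ε) ∘ f) ≤ ENNReal.ofReal (K * |ε|) := by
  have hcS : IsCompact ((A.χ j).symm '' tsupport ρ) := isCompact_symm_image hc hS
  have hcf : IsCompact (f ⁻¹' ((A.χ j).symm '' tsupport ρ)) :=
    f.toHomeomorph.isCompact_preimage.2 hcS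
  -- Only finitely many `K i` are sent by `f` to points of the support; on the others the map is
  -- unchanged, so one constant covers the whole supremum.
  have hfin := A.locallyFinite_K.finite_nonempty_inter_compact hcf
  have hlocal : ∀ i, ∀ᶠ K : ℝ in atTop, ∀ x ∈ A.K i, ∀ ε, |ε| < K⁻¹ →
      chartConj (A.χ j) (bumpShift ρ v ε) (f x) ∈ (A.χ (A.t i)).source ∧ ∀ k ≤ r,
        (A.w i : ℝ≥0∞) * edist (iteratedFDeriv ℝ k (A.local_rep f i) (A.χ i x))
          (iteratedFDeriv ℝ k
            (A.local_rep (chartConj (A.χ j) (bumpShift ρ v ε) ∘ f) i) (A.χ i x)) ≤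
          ENNReal.ofReal (K * |ε|) := by
    intro i
    refine eventually_atTop_forall_of_isCompact (A.isCompact_K i) fun p hp => ?_
    obtain ⟨U, hU, h⟩ := eventually_edist_iteratedFDeriv_le (v := v) (A.χ_mem j) (A.χ_mem i)
      (A.χ_mem (A.t i)) (A.χ_compat j (A.t i)) hρ hc hS f.contMDiff (A.K_subset i hp) (hf i hp)
      (A.w i)
    exact ⟨U, mem_nhdsWithin_of_mem_nhds hU, h⟩
  filter_upwards [(eventually_all_finite hfin).2 fun i _ => hlocal i] with K hK ε hε
  have key : ∀ i, ∀ x ∈ A.K i,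
      chartConj (A.χ j) (bumpShift ρ v ε) (f x) ∈ (A.χ (A.t i)).source ∧ ∀ k ≤ r,
        (A.w i : ℝ≥0∞) * edist (iteratedFDeriv ℝ k (A.local_rep f i) (A.χ i x))
          (iteratedFDeriv ℝ k
            (A.local_rep (chartConj (A.χ j) (bumpShift ρ v ε) ∘ f) i) (A.χ i x)) ≤
          ENNReal.ofReal (K * |ε|) := by
    intro i x hx
    by_cases hi : (A.K i ∩ f ⁻¹' ((A.χ j).symm '' tsupport ρ)).Nonempty
    · exact hK i hi x hx ε hε
    · have hnot : ∀ y, f y ∈ ((A.χ j).symm '' tsupport ρ)ᶜ →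
          chartConj (A.χ j) (bumpShift ρ v ε) (f y) = f y := fun y hy =>
        chartConj_of_notMem (fun w hw => bumpShift_of_notMem hw) hy
      have hfx : f x ∈ ((A.χ j).symm '' tsupport ρ)ᶜ := fun h => hi ⟨x, hx, h⟩
      refine ⟨by rw [hnot x hfx]; exact hf i hx, fun k hk => ?_⟩
      have hxs := A.K_subset i hx
      have heq : A.local_rep (chartConj (A.χ j) (bumpShift ρ v ε) ∘ f) i =ᶠ[𝓝 (A.χ i x)]
          A.local_rep f i := by
        have : ∀ᶠ w in 𝓝 (A.χ i x), (A.χ i).symm w ∈ f ⁻¹' ((A.χ j).symm '' tsupport ρ)ᶜ :=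
          ((A.χ i).continuousAt_symm ((A.χ i).map_source hxs)).eventually
            ((hcS.isClosed.isOpen_compl.preimage f.continuous).mem_nhds
              (by rw [(A.χ i).left_inv hxs]; exact hfx))
        filter_upwards [this] with w hw
        simp [CrGauge.local_rep, hnot _ hw]
      rw [(heq.iteratedFDeriv ℝ k).eq_of_nhds, edist_self, mul_zero]
      exact zero_le
  refine ⟨fun i x hx => (key i x hx).1, ?_⟩
  simp only [CrGauge.crDist, iSup_le_iff]
  exact fun i k hk x hx => (key i x hx).2 k hk

end CrEstimates

/-! ### The coordinate along the centre direction. -/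

section CentreForm

variable {E : Type*} [NormedAddCommGroup E] [NormedSpace ℝ E]
  {M : Type*} [TopologicalSpace M] [ChartedSpace E M]

/-- `θ` is the coordinate along `X` for a splitting whose other summands are `Es` and `Eu`. -/
structure IsCentreForm (Λ : Set M) (Es Eu : ∀ x : M, Submodule ℝ (TangentSpace 𝓘(ℝ, E) x))
    (X : ∀ x : M, TangentSpace 𝓘(ℝ, E) x) (θ : ∀ x : M, TangentSpace 𝓘(ℝ, E) x →ₗ[ℝ] ℝ) :
    Prop where
  apply_field : ∀ x ∈ Λ, θ x (X x) = 1
  apply_s : ∀ x ∈ Λ, ∀ v ∈ Es x, θ x v = 0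
  apply_u : ∀ x ∈ Λ, ∀ v ∈ Eu x, θ x v = 0

/-- A family of linear forms on the tangent spaces can be read in a chart. -/
theorem exists_chart_form [FiniteDimensional ℝ E] (χ : OpenPartialHomeomorph M E)
    (hχ : χ ∈ IsManifold.maximalAtlas 𝓘(ℝ, E) 1 M)
    (θ : ∀ x : M, TangentSpace 𝓘(ℝ, E) x →ₗ[ℝ] ℝ) :
    ∃ l : M → E →L[ℝ] ℝ, ∀ x ∈ χ.source, ∀ v, l x (chartDeriv χ x v) = θ x v := by
  have h : ∀ x : M, ∃ l : E →L[ℝ] ℝ, x ∈ χ.source → ∀ v, l (chartDeriv χ x v) = θ x v := by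
    intro x
    by_cases hx : x ∈ χ.source
    · let e := LinearEquiv.ofBijective (chartDeriv χ x).toLinearMap (chartDeriv_bijective hχ hx)
      refine ⟨LinearMap.toContinuousLinearMap (θ x ∘ₗ e.symm.toLinearMap), fun _ v => ?_⟩
      change θ x (e.symm (e v)) = θ x v
      rw [e.symm_apply_apply]
    · exact ⟨0, fun h => absurd h hx⟩
  choose l hl using h
  exact ⟨l, hl⟩

variable {Λ : Set M}
  {Es Ec Eu : ∀ x : M, Submodule ℝ (TangentSpace 𝓘(ℝ, E) x)}
  {X : ∀ x : M, TangentSpace 𝓘(ℝ, E) x} {θ : ∀ x : M, TangentSpace 𝓘(ℝ, E) x →ₗ[ℝ] ℝ} {r : ℕ}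
  {f : M ≃ₘ^r⟮𝓘(ℝ, E), 𝓘(ℝ, E)⟯ M}

/-- The derivative of `f` multiplies the coordinate along `X` by `a`. -/
theorem IsCentreForm.apply_mfderiv (hθ : IsCentreForm Λ Es Eu X θ)
    (hs : IsDInvariant f Λ Es) (hu : IsDInvariant f Λ Eu)
    (hspan : ∀ x ∈ Λ, Es x ⊔ Submodule.span ℝ {X x} ⊔ Eu x = ⊤) (hf : MapsTo f Λ Λ) {a : M → ℝ}
    (ha : ∀ x ∈ Λ, mfderiv 𝓘(ℝ, E) 𝓘(ℝ, E) f x (X x) = a x • X (f x)) {x : M} (hx : x ∈ Λ)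
    (v : TangentSpace 𝓘(ℝ, E) x) :
    θ (f x) (mfderiv 𝓘(ℝ, E) 𝓘(ℝ, E) f x v) = a x * θ x v := by
  have hv : v ∈ Es x ⊔ Submodule.span ℝ {X x} ⊔ Eu x := hspan x hx ▸ Submodule.mem_top
  obtain ⟨w, hw, u, hu', rfl⟩ := Submodule.mem_sup.1 hv
  obtain ⟨s, hs', c, hc, rfl⟩ := Submodule.mem_sup.1 hw
  obtain ⟨t, rfl⟩ := Submodule.mem_span_singleton.1 hc
  have e1 : θ (f x) (mfderiv 𝓘(ℝ, E) 𝓘(ℝ, E) f x s) = 0 :=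
    hθ.apply_s _ (hf hx) _ (hs x hx ▸ Submodule.mem_map_of_mem hs')
  have e2 : θ (f x) (mfderiv 𝓘(ℝ, E) 𝓘(ℝ, E) f x u) = 0 :=
    hθ.apply_u _ (hf hx) _ (hu x hx ▸ Submodule.mem_map_of_mem hu')
  have e3 : θ (f x) (mfderiv 𝓘(ℝ, E) 𝓘(ℝ, E) f x (t • X x)) = t * a x := by
    rw [map_smul, ha x hx, map_smul, map_smul, hθ.apply_field _ (hf hx)]
    simp
  rw [map_add, map_add, map_add, map_add, e1, e2, e3, map_add, map_add, hθ.apply_s x hx s hs',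
    hθ.apply_u x hx u hu', map_smul, hθ.apply_field x hx]
  simp [mul_comm]

variable [IsManifold 𝓘(ℝ, E) 1 M]

/-- The coordinate along `X`, read in a chart, is continuous. -/
theorem IsCentreForm.continuousWithinAt (hθ : IsCentreForm Λ Es Eu X θ)
    (hs : IsSubbundle Λ Es) (hu : IsSubbundle Λ Eu) (hX : ContinuousField Λ X)
    (hspan : ∀ x ∈ Λ, Es x ⊔ Submodule.span ℝ {X x} ⊔ Eu x = ⊤)
    (hdis : ∀ x ∈ Λ, Disjoint (Es x) (Eu x))
    {χ : OpenPartialHomeomorph M E} (hχ : χ ∈ IsManifold.maximalAtlas 𝓘(ℝ, E) 1 M)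
    {l : M → E →L[ℝ] ℝ} (hl : ∀ x ∈ χ.source, ∀ v, l x (chartDeriv χ x v) = θ x v)
    {p : M} (hp : p ∈ Λ) (hpχ : p ∈ χ.source) : ContinuousWithinAt l Λ p := by
  obtain ⟨U, hU, k, b, hbc, hb⟩ := hs p hp
  obtain ⟨U', hU', k', b', hbc', hb'⟩ := hu p hp
  have hpU := mem_of_mem_nhds hU
  have hpU' := mem_of_mem_nhds hU'
  -- Local frames of Es and Eu together with `X` form a continuous frame of the tangent bundle on
  -- which θ takes the constant values 0, 0, 1.
  let fr : (Fin k ⊕ Fin k') ⊕ Unit → ∀ y : M, TangentSpace 𝓘(ℝ, E) y :=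
    Sum.elim (Sum.elim b b') fun _ => X
  have hfr : ∀ i, ContinuousWithinAt (fun q => chartDeriv χ q (fr i q)) Λ p := by
    rintro ((i | i) | _)
    · refine (continuousWithinAt_chartDeriv_apply hχ (hbc i) ⟨hpU, hp⟩ hpχ).mono_of_mem_nhdsWithin ?_
      rw [inter_comm]
      exact inter_mem_nhdsWithin _ hU
    · refine (continuousWithinAt_chartDeriv_apply hχ (hbc' i) ⟨hpU', hp⟩ hpχ).mono_of_mem_nhdsWithin ?_
      rw [inter_comm]
      exact inter_mem_nhdsWithin _ hU'
    · exact continuousWithinAt_chartDeriv_apply hχ hX hp hpχ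
  have hvec : LinearIndependent ℝ fun i => fr i p := by
    have h1 : LinearIndependent ℝ (Sum.elim (fun i => b i p) fun i => b' i p) :=
      (hb p ⟨hpU, hp⟩).1.sum_type (hb' p ⟨hpU', hp⟩).1 (by
        rw [(hb p ⟨hpU, hp⟩).2, (hb' p ⟨hpU', hp⟩).2]
        exact hdis p hp)
    have h2 : LinearIndependent ℝ fun _ : Unit => X p :=
      linearIndependent_unique_iff.2 fun h => by
        have := hθ.apply_field p hp
        simp [show X p = 0 from h] at this
    have h3 := h1.sum_type h2 (by
      rw [Submodule.disjoint_def]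
      intro x hx hx'
      have e1 : θ p x = 0 := by
        have hle : Submodule.span ℝ (range (Sum.elim (fun i => b i p) fun i => b' i p)) ≤
            LinearMap.ker (θ p) := by
          rw [Submodule.span_le]
          rintro _ ⟨i | i, rfl⟩
          · exact hθ.apply_s p hp _ ((hb p ⟨hpU, hp⟩).2 ▸ Submodule.subset_span ⟨i, rfl⟩)
          · exact hθ.apply_u p hp _ ((hb' p ⟨hpU', hp⟩).2 ▸ Submodule.subset_span ⟨i, rfl⟩)
        exact hle hx
      rw [range_const, Submodule.mem_span_singleton] at hx'
      obtain ⟨t, rfl⟩ := hx'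
      rw [map_smul, hθ.apply_field p hp] at e1
      simp at e1
      simp [e1])
    have e : (fun i => fr i p) =
        Sum.elim (Sum.elim (fun i => b i p) fun i => b' i p) fun _ => X p := by
      funext i
      rcases i with ((i | i) | _) <;> rfl
    rw [e]
    exact h3
  have hspan' : Submodule.span ℝ (range fun i => fr i p) = ⊤ := by
    rw [eq_top_iff, ← hspan p hp, ← (hb p ⟨hpU, hp⟩).2, ← (hb' p ⟨hpU', hp⟩).2]
    refine sup_le (sup_le ?_ ?_) ?_ <;> refine Submodule.span_mono ?_
    · rintro _ ⟨i, rfl⟩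
      exact ⟨Sum.inl (Sum.inl i), rfl⟩
    · rintro _ rfl
      exact ⟨Sum.inr (), rfl⟩
    · rintro _ ⟨i, rfl⟩
      exact ⟨Sum.inl (Sum.inr i), rfl⟩
  refine continuousWithinAt_of_apply_frame (b := fun i q => chartDeriv χ q (fr i q))
    (c := Sum.elim (fun _ => 0) fun _ => 1) hp hfr ?_ ?_ ?_
  · exact hvec.map' (chartDeriv χ p).toLinearMap
      (LinearMap.ker_eq_bot.2 (chartDeriv_bijective hχ hpχ).1)
  · have h1 : (range fun i => chartDeriv χ p (fr i p)) =
        (chartDeriv χ p).toLinearMap '' range fun i => fr i p := by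
      rw [← range_comp]
      rfl
    rw [h1, ← Submodule.map_span, hspan', Submodule.map_top]
    exact (LinearMap.range_eq_top.2 (chartDeriv_bijective hχ hpχ).2).ge
  · filter_upwards [self_mem_nhdsWithin, mem_nhdsWithin_of_mem_nhds hU,
      mem_nhdsWithin_of_mem_nhds hU', mem_nhdsWithin_of_mem_nhds (χ.open_source.mem_nhds hpχ)]
      with q hq hqU hqU' hqχ
    rintro ((i | i) | _)
    · rw [hl q hqχ]
      exact hθ.apply_s q hq _ ((hb q ⟨hqU, hq⟩).2 ▸ Submodule.subset_span ⟨i, rfl⟩)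
    · rw [hl q hqχ]
      exact hθ.apply_u q hq _ ((hb' q ⟨hqU', hq⟩).2 ▸ Submodule.subset_span ⟨i, rfl⟩)
    · rw [hl q hqχ]
      exact hθ.apply_field q hq

variable [RiemannianBundle (fun x : M => TangentSpace 𝓘(ℝ, E) x)]

theorem span_field_eq (hdim : ∀ x ∈ Λ, Module.finrank ℝ (Ec x) = 1) (hX : IsOrientation Λ Ec X)
    {x : M} (hx : x ∈ Λ) : Submodule.span ℝ {X x} = Ec x := by
  have hX0 : X x ≠ 0 := fun h => by
    have := (hX.2 x hx).2
    simp [h] at this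
  have hfin : Module.Finite ℝ (Ec x) := Module.finite_of_finrank_eq_succ (hdim x hx)
  refine Submodule.eq_of_le_of_finrank_eq
    ((Submodule.span_singleton_le_iff_mem _ _).2 (hX.2 x hx).1) ?_
  rw [hdim x hx, finrank_span_singleton hX0]

theorem IsPartiallyHyperbolic.exists_isCentreForm (hph : IsPartiallyHyperbolic f Λ Es Ec Eu)
    (hX : IsOrientation Λ Ec X) : ∃ θ, IsCentreForm Λ Es Eu X θ := by
  have h : ∀ x : M, ∃ θ : TangentSpace 𝓘(ℝ, E) x →ₗ[ℝ] ℝ,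
      x ∈ Λ → θ (X x) = 1 ∧ ∀ w ∈ Es x ⊔ Eu x, θ w = 0 := by
    intro x
    by_cases hx : x ∈ Λ
    · obtain ⟨θ, hθ⟩ := exists_linearMap_eq_one (W := Es x ⊔ Eu x) (x := X x) fun hmem => by
        obtain ⟨s, hs, u, hu, hsu⟩ := Submodule.mem_sup.1 hmem
        have hu' : u ∈ Es x ⊔ Ec x := by
          rw [show u = -s + X x by rw [← hsu]; abel]
          exact Submodule.add_mem_sup (neg_mem hs) (hX.2 x hx).1
        have hu0 : u = 0 := Submodule.disjoint_def.1 (hph.isCompl_sc_u x hx).disjoint u hu' hu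
        have hX0 : X x = 0 := Submodule.disjoint_def.1 (hph.disjoint_s_c x hx) (X x)
          (by rw [← hsu, hu0, add_zero]; exact hs) (hX.2 x hx).1
        have := (hX.2 x hx).2
        simp [hX0] at this
      exact ⟨θ, fun _ => hθ⟩
    · exact ⟨0, fun h => absurd h hx⟩
  choose θ hθ using h
  exact ⟨θ, fun x hx => (hθ x hx).1, fun x hx v hv => (hθ x hx).2 v (Submodule.mem_sup_left hv),
    fun x hx v hv => (hθ x hx).2 v (Submodule.mem_sup_right hv)⟩

theorem IsPartiallyHyperbolic.sup_span_eq_top (hph : IsPartiallyHyperbolic f Λ Es Ec Eu)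
    (hdim : ∀ x ∈ Λ, Module.finrank ℝ (Ec x) = 1) (hX : IsOrientation Λ Ec X) {x : M}
    (hx : x ∈ Λ) : Es x ⊔ Submodule.span ℝ {X x} ⊔ Eu x = ⊤ := by
  rw [span_field_eq hdim hX hx]
  exact (hph.isCompl_sc_u x hx).sup_eq_top

theorem IsPartiallyHyperbolic.disjoint_s_u (hph : IsPartiallyHyperbolic f Λ Es Ec Eu) {x : M}
    (hx : x ∈ Λ) : Disjoint (Es x) (Eu x) :=
  (hph.isCompl_sc_u x hx).disjoint.mono_left le_sup_left

variable [IsContinuousRiemannianBundle E (fun x : M => TangentSpace 𝓘(ℝ, E) x)]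

/-- The coordinate along `X` is bounded over a compact set. -/
theorem IsCentreForm.exists_bound [FiniteDimensional ℝ E] (hθ : IsCentreForm Λ Es Eu X θ)
    (hΛ : IsCompact Λ)
    (hs : IsSubbundle Λ Es) (hu : IsSubbundle Λ Eu) (hX : ContinuousField Λ X)
    (hspan : ∀ x ∈ Λ, Es x ⊔ Submodule.span ℝ {X x} ⊔ Eu x = ⊤)
    (hdis : ∀ x ∈ Λ, Disjoint (Es x) (Eu x)) :
    ∃ K : ℝ, 0 < K ∧ ∀ x ∈ Λ, ∀ v : TangentSpace 𝓘(ℝ, E) x, |θ x v| ≤ K * ‖v‖ := by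
  have key : ∀ᶠ K : ℝ in atTop, ∀ x ∈ Λ, ∀ v : TangentSpace 𝓘(ℝ, E) x, |θ x v| ≤ K * ‖v‖ := by
    refine eventually_atTop_forall_of_isCompact hΛ fun p hp => ?_
    have hχ : chartAt E p ∈ IsManifold.maximalAtlas 𝓘(ℝ, E) 1 M :=
      IsManifold.chart_mem_maximalAtlas p
    obtain ⟨l, hl⟩ := exists_chart_form (chartAt E p) hχ θ
    have hlc := hθ.continuousWithinAt hs hu hX hspan hdis hχ hl hp (mem_chart_source E p)
    obtain ⟨C, hC, hCp⟩ := eventually_norm_chartDeriv_le hχ (mem_chart_source E p)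
    refine ⟨_, (hlc.norm.eventually (gt_mem_nhds (lt_add_one _))).and
      (mem_nhdsWithin_of_mem_nhds (inter_mem hCp (chart_source_mem_nhds E p))), ?_⟩
    filter_upwards [eventually_ge_atTop ((‖l p‖ + 1) * C)] with K hK x hx v
    rw [← hl x hx.2.2, ← Real.norm_eq_abs]
    calc ‖l x (chartDeriv (chartAt E p) x v)‖ ≤ ‖l x‖ * ‖chartDeriv (chartAt E p) x v‖ :=
          (l x).le_opNorm _
      _ ≤ (‖l p‖ + 1) * (C * ‖v‖) := by
          gcongr
          · exact hx.1.le
          · exact hx.2.1 v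
      _ = (‖l p‖ + 1) * C * ‖v‖ := by ring
      _ ≤ K * ‖v‖ := by gcongr
  obtain ⟨K, hK, hK0⟩ := (key.and (eventually_gt_atTop 0)).exists
  exact ⟨K, hK0, hK⟩

end CentreForm

/-! ### One step of the perturbed orbit, expanded to first order. -/

section Step

variable {E : Type*} [NormedAddCommGroup E] [NormedSpace ℝ E]

theorem chartConj_bumpShift_zero {M : Type*} [TopologicalSpace M]
    (χ : OpenPartialHomeomorph M E) (ρ : E → ℝ) (v : E) (x : M) :
    chartConj χ (bumpShift ρ v 0) x = x := by
  rw [bumpShift_zero]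
  exact chartConj_of_notMem (S := ∅) (fun _ _ => rfl) (by simp)

/-- Local estimates for the members of a locally finite closed family can be made simultaneously
for all of them. -/
theorem exists_nhdsWithin_forall_mem_locallyFinite {X ι : Type*} [TopologicalSpace X]
    {B : ι → Set X} (hB : LocallyFinite B) (hc : ∀ i, IsClosed (B i)) {s : Set X} {p : X}
    {P : ℝ → ι → X → Prop}
    (h : ∀ i, p ∈ B i → ∃ U ∈ 𝓝[s] p, ∀ᶠ K in atTop, ∀ x ∈ U, P K i x) :
    ∃ U ∈ 𝓝[s] p, ∀ᶠ K in atTop, ∀ x ∈ U, ∀ i, x ∈ B i → P K i x := by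
  have hfin : {i | p ∈ B i}.Finite := hB.point_finite p
  choose! U hU hP using h
  -- Local finiteness and closedness ensure that points near p meet only members that contain p, and
  -- these are finitely many.
  refine ⟨(⋂ i ∈ {i | p ∈ B i}, U i) ∩ {x | {i | x ∈ B i} ⊆ {i | p ∈ B i}}, inter_mem
    ((biInter_mem hfin).2 hU) (mem_nhdsWithin_of_mem_nhds (hB.eventually_subset hc p)), ?_⟩
  filter_upwards [(eventually_all_finite hfin).2 hP] with K hK x hx i hi
  have hpi : p ∈ B i := hx.2 hi
  exact hK i hpi x (mem_iInter₂.1 hx.1 i hpi)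

/-- First order expansion, along the invariant set, of the centre coordinate of the displacement
of a perturbed orbit. -/
theorem eventually_step_le {M : Type*} [TopologicalSpace M] [T2Space M] [ChartedSpace E M]
    {χ χ₁ χ₂ : OpenPartialHomeomorph M E} {ρ : E → ℝ} {v : E} {r : ℕ}
    {f : M → M} {p : M} {Λ : Set M} {a : M → ℝ} {θ : ∀ x : M, TangentSpace 𝓘(ℝ, E) x →ₗ[ℝ] ℝ}
    {l₁ l₂ : M → E →L[ℝ] ℝ} (hr : 2 ≤ r) (hχ : χ ∈ IsManifold.maximalAtlas 𝓘(ℝ, E) r M)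
    (hχ₁ : χ₁ ∈ IsManifold.maximalAtlas 𝓘(ℝ, E) r M)
    (hχ₂ : χ₂ ∈ IsManifold.maximalAtlas 𝓘(ℝ, E) r M) (hρ : ContDiff ℝ ∞ ρ)
    (hc : HasCompactSupport ρ) (hS : tsupport ρ ⊆ χ.target)
    (hf : ContMDiff 𝓘(ℝ, E) 𝓘(ℝ, E) r f) (hΛ : MapsTo f Λ Λ)
    (hp : p ∈ χ₁.source) (hfp : f p ∈ χ₂.source)
    {V : ∀ q : M, TangentSpace 𝓘(ℝ, E) q}
    (hV : ∀ q ∈ χ.source, chartDeriv χ q (V q) = ρ (χ q) • v) (hV' : ∀ q ∉ χ.source, V q = 0)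
    (hl₁ : ∀ x ∈ χ₁.source, ∀ u, l₁ x (chartDeriv χ₁ x u) = θ x u)
    (hl₂ : ∀ x ∈ χ₂.source, ∀ u, l₂ x (chartDeriv χ₂ x u) = θ x u)
    (hlc : ContinuousWithinAt l₂ Λ (f p))
    (hθ : ∀ x ∈ Λ, ∀ u, θ (f x) (mfderiv 𝓘(ℝ, E) 𝓘(ℝ, E) f x u) = a x * θ x u) :
    ∃ U ∈ 𝓝[Λ] p, ∀ᶠ K : ℝ in atTop, ∀ x ∈ U, ∀ y ∈ χ₁.source, ‖χ₁ y - χ₁ x‖ < K⁻¹ →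
      ∀ ε, |ε| < K⁻¹ →
        |l₂ (f x) (χ₂ (chartConj χ (bumpShift ρ v ε) (f y)) - χ₂ (f x)) -
          a x * l₁ x (χ₁ y - χ₁ x) - ε * θ (f x) (V (f x))| ≤
          K * (|ε| + ‖χ₁ y - χ₁ x‖) ^ 2 := by
  have hF : ContDiffAt ℝ 2 (shiftRep χ χ₁ χ₂ ρ v f) (0, χ₁ p) :=
    (contDiffAt_shiftRep hχ hχ₁ hχ₂ hρ hc hS hf.contMDiffAt hp hfp).of_le (by exact_mod_cast hr)
  obtain ⟨K₁, hK₁, hK₁0⟩ := ((eventually_taylor_of_contDiffAt hF).and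
    (eventually_gt_atTop 0)).exists
  have hr' : (1 : ℕ∞ω) ≤ r := by exact_mod_cast (by lia : 1 ≤ r)
  have hball : ∀ᶠ x in 𝓝 p, χ₁ x ∈ Metric.ball (χ₁ p) (K₁⁻¹ / 2) :=
    (χ₁.continuousAt hp).eventually (Metric.ball_mem_nhds _ (by positivity))
  have hlf : ContinuousWithinAt (fun x => l₂ (f x)) Λ p :=
    hlc.comp hf.continuous.continuousWithinAt hΛ
  refine ⟨_, inter_mem self_mem_nhdsWithin (inter_mem
    (hlf.norm.eventually (gt_mem_nhds (lt_add_one _))) (mem_nhdsWithin_of_mem_nhds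
    (inter_mem hball (inter_mem (χ₁.open_source.mem_nhds hp)
      ((χ₂.open_source.preimage hf.continuous).mem_nhds hfp))))), ?_⟩
  filter_upwards [eventually_ge_atTop (2 * K₁),
    eventually_ge_atTop ((‖l₂ (f p)‖ + 1) * K₁)] with K h1 h2
  rintro x ⟨hxΛ, hxl, hxb, hx₁, hx₂⟩ y hy hxy ε hε
  have hKinv : K⁻¹ ≤ K₁⁻¹ / 2 := by
    rw [← inv_inv (K₁⁻¹ / 2)]
    refine inv_anti₀ (by positivity) ?_
    rw [inv_div, div_inv_eq_mul]
    exact h1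
  have hhalf : K₁⁻¹ / 2 < K₁⁻¹ := half_lt_self (inv_pos.2 hK₁0)
  have m1 : ((0 : ℝ), χ₁ x) ∈ Metric.ball ((0 : ℝ), χ₁ p) K₁⁻¹ := by
    rw [← ball_prod_same]
    exact ⟨Metric.mem_ball_self (inv_pos.2 hK₁0), Metric.ball_subset_ball hhalf.le hxb⟩
  have m2 : (ε, χ₁ y) ∈ Metric.ball ((0 : ℝ), χ₁ p) K₁⁻¹ := by
    rw [← ball_prod_same]
    refine ⟨?_, ?_⟩
    · rw [mem_ball_zero_iff, Real.norm_eq_abs]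
      linarith
    · change dist (χ₁ x) (χ₁ p) < K₁⁻¹ / 2 at hxb
      rw [Metric.mem_ball]
      have := dist_triangle (χ₁ y) (χ₁ x) (χ₁ p)
      rw [dist_eq_norm (χ₁ y) (χ₁ x)] at this
      linarith
  -- The chart displacement becomes a tangent vector at x itself, not at p, so that θ ∘ Df = a θ
  -- applies exactly at x.
  obtain ⟨u, hu⟩ := (chartDeriv_bijective (IsManifold.maximalAtlas_subset_of_le hr' hχ₁) hx₁).2
    (χ₁ y - χ₁ x)
  have ht := hK₁ _ m1 _ m2
  have hder := fderiv_shiftRep (v := v) (by lia : 1 ≤ r) hχ hχ₁ hχ₂ hρ hc hS hf.contMDiffAt hx₁ hx₂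
    hV hV' ε u
  rw [hu] at hder
  rw [Prod.mk_sub_mk, sub_zero, hder] at ht
  have e1 : shiftRep χ χ₁ χ₂ ρ v f (ε, χ₁ y) = χ₂ (chartConj χ (bumpShift ρ v ε) (f y)) := by
    simp [shiftRep, χ₁.left_inv hy]
  have e2 : shiftRep χ χ₁ χ₂ ρ v f (0, χ₁ x) = χ₂ (f x) := by
    simp [shiftRep, χ₁.left_inv hx₁, chartConj_bumpShift_zero]
  rw [e1, e2] at ht
  have e3 : l₂ (f x) (χ₂ (chartConj χ (bumpShift ρ v ε) (f y)) - χ₂ (f x)) -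
      a x * l₁ x (χ₁ y - χ₁ x) - ε * θ (f x) (V (f x)) =
      l₂ (f x) (χ₂ (chartConj χ (bumpShift ρ v ε) (f y)) - χ₂ (f x) -
        chartDeriv χ₂ (f x) (mfderiv 𝓘(ℝ, E) 𝓘(ℝ, E) f x u + ε • V (f x))) := by
    rw [map_sub (l₂ (f x)) (χ₂ (chartConj χ (bumpShift ρ v ε) (f y)) - χ₂ (f x)), hl₂ _ hx₂,
      map_add, map_smul, hθ x hxΛ, ← hu, hl₁ x hx₁, smul_eq_mul]
    ring
  rw [e3, ← Real.norm_eq_abs]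
  have hn : ‖(ε, χ₁ y - χ₁ x)‖ ≤ |ε| + ‖χ₁ y - χ₁ x‖ := by
    rw [Prod.norm_mk, Real.norm_eq_abs]
    exact max_le_add_of_nonneg (abs_nonneg _) (norm_nonneg _)
  calc _ ≤ ‖l₂ (f x)‖ * (K₁ * ‖(ε, χ₁ y - χ₁ x)‖ ^ 2) :=
        (l₂ (f x)).le_opNorm_of_le ht
    _ ≤ (‖l₂ (f p)‖ + 1) * (K₁ * (|ε| + ‖χ₁ y - χ₁ x‖) ^ 2) := by
        gcongr
        exact hxl.le
    _ = (‖l₂ (f p)‖ + 1) * K₁ * (|ε| + ‖χ₁ y - χ₁ x‖) ^ 2 := by ring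
    _ ≤ K * (|ε| + ‖χ₁ y - χ₁ x‖) ^ 2 := by gcongr

end Step

/-! ### Where the exponent 1/2 matters. -/

section Exponents

/-- Squares of `ε ^ α` are small compared to `ε` if `α > 1 / 2`. -/
theorem eventually_sq_add_rpow_le {α : ℝ} (hα : 1 / 2 < α) (D K : ℝ) {c : ℝ} (hc : 0 < c) :
    ∀ᶠ ε : ℝ in 𝓝[>] 0, K * (ε + D * ε ^ α) ^ 2 ≤ c * ε := by
  have hid : Tendsto (fun ε : ℝ => ε) (𝓝[>] 0) (𝓝 0) := nhdsWithin_le_nhds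
  -- Taking ε^(1/2) out of the bracket leaves a factor that tends to 0 because α - 1/2 > 0.
  have h1 : Tendsto (fun ε : ℝ => K * (ε ^ (1 / 2 : ℝ) + D * ε ^ (α - 1 / 2)) ^ 2) (𝓝[>] 0)
      (𝓝 0) := by
    have e1 : Tendsto (fun ε : ℝ => ε ^ (1 / 2 : ℝ)) (𝓝[>] 0) (𝓝 0) := by
      simpa using hid.rpow_const (p := (1 / 2 : ℝ)) (Or.inr (by norm_num))
    have e2 : Tendsto (fun ε : ℝ => ε ^ (α - 1 / 2)) (𝓝[>] 0) (𝓝 0) := by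
      have h := hid.rpow_const (p := α - 1 / 2) (Or.inr (by linarith))
      rwa [Real.zero_rpow (sub_pos.2 hα).ne'] at h
    simpa using ((e1.add (e2.const_mul D)).pow 2).const_mul K
  filter_upwards [h1.eventually (gt_mem_nhds hc), self_mem_nhdsWithin] with ε hε hε0
  have hε0' : (0 : ℝ) < ε := hε0
  have e1 : ε ^ (1 / 2 : ℝ) * ε ^ (1 / 2 : ℝ) = ε := by
    rw [← Real.rpow_add hε0']
    norm_num
  have e2 : ε ^ (1 / 2 : ℝ) * ε ^ (α - 1 / 2) = ε ^ α := by
    rw [← Real.rpow_add hε0']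
    congr 1
    ring
  have e3 : K * (ε + D * ε ^ α) ^ 2 =
      K * (ε ^ (1 / 2 : ℝ) + D * ε ^ (α - 1 / 2)) ^ 2 * ε := by
    calc _ = K * (ε ^ (1 / 2 : ℝ) * ε ^ (1 / 2 : ℝ) +
          D * (ε ^ (1 / 2 : ℝ) * ε ^ (α - 1 / 2))) ^ 2 := by rw [e1, e2]
      _ = K * (ε ^ (1 / 2 : ℝ) + D * ε ^ (α - 1 / 2)) ^ 2 *
          (ε ^ (1 / 2 : ℝ) * ε ^ (1 / 2 : ℝ)) := by ring
      _ = _ := by rw [e1]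
  rw [e3]
  gcongr

theorem eventually_const_mul_rpow_lt {α : ℝ} (hα : 0 < α) (D : ℝ) {δ : ℝ} (hδ : 0 < δ) :
    ∀ᶠ ε : ℝ in 𝓝[>] 0, D * ε ^ α < δ := by
  have hid : Tendsto (fun ε : ℝ => ε) (𝓝[>] 0) (𝓝 0) := nhdsWithin_le_nhds
  have h : Tendsto (fun ε : ℝ => D * ε ^ α) (𝓝[>] 0) (𝓝 0) := by
    simpa [Real.zero_rpow hα.ne'] using (hid.rpow_const (p := α) (Or.inr hα.le)).const_mul D
  exact h.eventually (gt_mem_nhds hδ)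

end Exponents

/-! ### From conjugacies to approximate solutions of the cohomological equation. -/

section Perturbation

variable {E : Type*} [NormedAddCommGroup E] [NormedSpace ℝ E] [FiniteDimensional ℝ E]
  {M : Type*} [EMetricSpace M] [ChartedSpace E M] [IsManifold 𝓘(ℝ, E) 1 M]
  [RiemannianBundle (fun x : M => TangentSpace 𝓘(ℝ, E) x)]
  [IsContinuousRiemannianBundle E (fun x : M => TangentSpace 𝓘(ℝ, E) x)]
  [IsRiemannianManifold 𝓘(ℝ, E) M]

/-- Hölder stability with exponent larger than `1 / 2` yields bounded approximate solutions of the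
cohomological equation whose right-hand side is the centre coordinate of a field supported in a
chart. -/
theorem eventually_exists_approximate_solution {r : ℕ} (hr : 2 ≤ r)
    {f : M ≃ₘ^r⟮𝓘(ℝ, E), 𝓘(ℝ, E)⟯ M} {Λ : Set M} (hΛc : IsCompact Λ) (hΛ : MapsTo f Λ Λ)
    {z : M} (hz : z ∈ Λ) {A : CrGauge E M r} (hA : A.Adapted f) {α : ℝ} (hα : 1 / 2 < α)
    {ε₀ C : ℝ≥0} (hε₀ : 0 < ε₀)
    (hstable : ∀ g : M ≃ₘ^r⟮𝓘(ℝ, E), 𝓘(ℝ, E)⟯ M, A.Adapted g → A.crDist f g < ε₀ →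
      ∃ φ : Λ → M, (∀ (x : Λ) (hx : f x ∈ Λ), φ ⟨f x, hx⟩ = g (φ x)) ∧
        ∀ x : Λ, edist (φ x) (x : M) ≤ C * (A.crDist f g) ^ α)
    {a : M → ℝ} {θ : ∀ x : M, TangentSpace 𝓘(ℝ, E) x →ₗ[ℝ] ℝ} {l : ℕ → M → E →L[ℝ] ℝ}
    (hl : ∀ i, ∀ x ∈ (A.χ i).source, ∀ u, l i x (chartDeriv (A.χ i) x u) = θ x u)
    (hlc : ∀ i, ∀ x ∈ Λ, x ∈ (A.χ i).source → ContinuousWithinAt (l i) Λ x)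
    (hθ : ∀ x ∈ Λ, ∀ u, θ (f x) (mfderiv 𝓘(ℝ, E) 𝓘(ℝ, E) f x u) = a x * θ x u)
    {ρ : E → ℝ} {v : E} {j : ℕ} (hρ : ContDiff ℝ ∞ ρ) (hc : HasCompactSupport ρ)
    (hS : tsupport ρ ⊆ (A.χ j).target) {V : ∀ q : M, TangentSpace 𝓘(ℝ, E) q}
    (hV : ∀ q ∈ (A.χ j).source, chartDeriv (A.χ j) q (V q) = ρ (A.χ j q) • v)
    (hV' : ∀ q ∉ (A.χ j).source, V q = 0) {c : ℝ} (hc0 : 0 < c) :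
    ∀ᶠ ε : ℝ in 𝓝[>] 0, ∃ u : ℕ → ℝ, (∃ B, ∀ n, |u n| ≤ B) ∧ ∀ n,
      |u (n + 1) - a (f^[n] z) * u n - ε * θ (f^[n + 1] z) (V (f^[n + 1] z))| ≤ c * ε := by
  have hr' : (1 : ℕ∞ω) ≤ r := by exact_mod_cast (by lia : 1 ≤ r)
  have hχ1 : ∀ i, A.χ i ∈ IsManifold.maximalAtlas 𝓘(ℝ, E) 1 M := fun i =>
    IsManifold.maximalAtlas_subset_of_le hr' (A.χ_mem i)
  have hKc : ∀ i, IsClosed (A.K i) := fun i => (A.isCompact_K i).isClosed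
  have hstep : ∀ᶠ K : ℝ in atTop, ∀ x ∈ Λ, ∀ i, x ∈ A.K i → ∀ i', f x ∈ A.K i' →
      ∀ y ∈ (A.χ i).source, ‖A.χ i y - A.χ i x‖ < K⁻¹ → ∀ ε, |ε| < K⁻¹ →
        |l i' (f x) (A.χ i' (chartConj (A.χ j) (bumpShift ρ v ε) (f y)) - A.χ i' (f x)) -
          a x * l i x (A.χ i y - A.χ i x) - ε * θ (f x) (V (f x))| ≤
          K * (|ε| + ‖A.χ i y - A.χ i x‖) ^ 2 := by
    refine eventually_atTop_forall_of_isCompact hΛc fun p hp => ?_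
    refine exists_nhdsWithin_forall_mem_locallyFinite A.locallyFinite_K hKc fun i hi => ?_
    refine exists_nhdsWithin_forall_mem_locallyFinite (B := fun i' => f ⁻¹' A.K i')
      (A.locallyFinite_K.preimage_continuous f.continuous)
      (fun i' => (hKc i').preimage f.continuous) fun i' hi' => ?_
    exact eventually_step_le hr (A.χ_mem j) (A.χ_mem i) (A.χ_mem i') hρ hc hS f.contMDiff hΛ
      (A.K_subset i hi) (A.K_subset i' hi') hV hV' (hl i) (hl i')
      (hlc i' _ (hΛ hp) (A.K_subset i' hi')) hθ
  have hlip : ∀ᶠ K : ℝ in atTop, ∀ x ∈ Λ, ∀ i, x ∈ A.K i → ∀ y,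
      edist y x < ENNReal.ofReal K⁻¹ →
      y ∈ (A.χ i).source ∧ ‖A.χ i y - A.χ i x‖ ≤ K * (edist y x).toReal := by
    refine eventually_atTop_forall_of_isCompact hΛc fun p hp => ?_
    refine exists_nhdsWithin_forall_mem_locallyFinite A.locallyFinite_K hKc fun i hi => ?_
    obtain ⟨U, hU, h⟩ := eventually_norm_chart_sub_le (hχ1 i) (A.K_subset i hi)
    exact ⟨U, mem_nhdsWithin_of_mem_nhds hU, h⟩
  have hlb : ∀ᶠ K : ℝ in atTop, ∀ x ∈ Λ, ∀ i, x ∈ A.K i → ‖l i x‖ ≤ K := by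
    refine eventually_atTop_forall_of_isCompact hΛc fun p hp => ?_
    refine exists_nhdsWithin_forall_mem_locallyFinite A.locallyFinite_K hKc fun i hi => ?_
    refine ⟨_, (hlc i p hp (A.K_subset i hi)).norm.eventually (gt_mem_nhds (lt_add_one _)), ?_⟩
    filter_upwards [eventually_ge_atTop (‖l i p‖ + 1)] with K hK x hx
    exact hx.le.trans hK
  obtain ⟨K, hKstep, hKlip, hKl, hKd, hKe, hK0⟩ := (hstep.and (hlip.and (hlb.and
    ((A.eventually_crDist_chartConj_le hA j hρ hc hS v).and
      ((eventually_exists_bumpShift_equiv hρ hc v).and (eventually_gt_atTop 0)))))).exists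
  have hKi : 0 < K⁻¹ := inv_pos.2 hK0
  have hα0 : 0 < α := by linarith
  have hid : Tendsto (fun ε : ℝ => ε) (𝓝[>] 0) (𝓝 0) := nhdsWithin_le_nhds
  have hlim : Tendsto (fun ε : ℝ => K * ε) (𝓝[>] 0) (𝓝 0) := by simpa using hid.const_mul K
  filter_upwards [self_mem_nhdsWithin, hid.eventually (gt_mem_nhds hKi),
    hlim.eventually (gt_mem_nhds (NNReal.coe_pos.2 hε₀)),
    eventually_const_mul_rpow_lt hα0 (C * K ^ α) hKi,
    eventually_const_mul_rpow_lt hα0 (K * (C * K ^ α)) hKi,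
    eventually_sq_add_rpow_le hα (K * (C * K ^ α)) K hc0] with ε hε0 hεK hεε₀ hε1 hε2 hε3
  have hε0' : (0 : ℝ) < ε := hε0
  have habs : |ε| = ε := abs_of_pos hε0'
  have hεK' : |ε| < K⁻¹ := by rwa [habs]
  obtain ⟨e, he, hes, hes'⟩ := hKe ε hεK'
  obtain ⟨Φ, hΦ⟩ := exists_diffeomorph_chartConj (n := r) (A.χ_mem j)
    (hes.of_le (by exact_mod_cast le_top)) (hes'.of_le (by exact_mod_cast le_top))
    (fun w hw => by rw [he]; exact bumpShift_of_notMem hw) hc hS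
  have hg : ⇑(f.trans Φ) = chartConj (A.χ j) (bumpShift ρ v ε) ∘ f := by
    rw [Diffeomorph.coe_trans, hΦ, he]
  obtain ⟨hgA, hgd⟩ := hKd ε hεK'
  rw [← hg] at hgA hgd
  rw [habs] at hgd
  have hgε₀ : A.crDist f (f.trans Φ) < ε₀ := by
    refine hgd.trans_lt ?_
    rw [← ENNReal.ofReal_coe_nnreal]
    exact (ENNReal.ofReal_lt_ofReal_iff (NNReal.coe_pos.2 hε₀)).2 hεε₀
  obtain ⟨φ, hφ, hφd⟩ := hstable _ hgA hgε₀
  -- the distance of the conjugacy to the inclusion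
  have hdist : ∀ x : Λ, edist (φ x) (x : M) ≤ ENNReal.ofReal (C * K ^ α * ε ^ α) := by
    intro x
    refine (hφd x).trans ?_
    rw [mul_assoc, ENNReal.ofReal_mul (NNReal.coe_nonneg C), ← Real.mul_rpow hK0.le hε0'.le,
      ← ENNReal.ofReal_rpow_of_nonneg (by positivity) hα0.le]
    change (C : ℝ≥0∞) * _ ≤ ENNReal.ofReal (C : ℝ) * _
    rw [ENNReal.ofReal_coe_nnreal]
    gcongr
  have hmem : ∀ n, f^[n] z ∈ Λ := fun n => hΛ.iterate n hz
  have hidx : ∀ x : M, ∃ i, x ∈ A.K i := fun x => by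
    have : x ∈ ⋃ i, A.K i := A.iUnion_K ▸ mem_univ x
    exact mem_iUnion.1 this
  -- Each orbit point is read in a chart chosen for it. The step estimate holds for every pair of
  -- charts, so consecutive charts may differ.
  choose ι hι using hidx
  let y : ℕ → M := fun n => φ ⟨f^[n] z, hmem n⟩
  have hysucc : ∀ n, y (n + 1) = chartConj (A.χ j) (bumpShift ρ v ε) (f (y n)) := by
    intro n
    have h1 := hφ ⟨f^[n] z, hmem n⟩ (hΛ (hmem n))
    rw [hg] at h1
    simp only [y, Function.iterate_succ_apply']
    exact h1
  have hclose : ∀ n, y n ∈ (A.χ (ι (f^[n] z))).source ∧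
      ‖A.χ (ι (f^[n] z)) (y n) - A.χ (ι (f^[n] z)) (f^[n] z)‖ ≤ K * (C * K ^ α) * ε ^ α := by
    intro n
    have h1 := hdist ⟨f^[n] z, hmem n⟩
    obtain ⟨h2, h3⟩ := hKlip _ (hmem n) _ (hι (f^[n] z)) (y n)
      (h1.trans_lt ((ENNReal.ofReal_lt_ofReal_iff hKi).2 hε1))
    refine ⟨h2, h3.trans ?_⟩
    rw [mul_assoc]
    gcongr
    exact ENNReal.toReal_le_of_le_ofReal (by positivity) h1
  -- The solution is the centre coordinate of the chart displacement from x_n to y_n.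
  refine ⟨fun n => l (ι (f^[n] z)) (f^[n] z)
    (A.χ (ι (f^[n] z)) (y n) - A.χ (ι (f^[n] z)) (f^[n] z)),
    ⟨K * (K * (C * K ^ α) * ε ^ α), fun n => ?_⟩, fun n => ?_⟩
  · rw [← Real.norm_eq_abs]
    refine (ContinuousLinearMap.le_opNorm _ _).trans ?_
    gcongr
    · exact hKl _ (hmem n) _ (hι _)
    · exact (hclose n).2
  · have h1 := hKstep _ (hmem n) _ (hι _) (ι (f^[n + 1] z))
      (by rw [← Function.iterate_succ_apply' f n z]; exact hι _) (y n) (hclose n).1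
      ((hclose n).2.trans_lt hε2) ε hεK'
    rw [← hysucc n, ← Function.iterate_succ_apply' f n z] at h1
    refine h1.trans (le_trans ?_ hε3)
    rw [habs]
    gcongr
    exact (hclose n).2

end Perturbation

/-! ### Calculus of approximate solutions. -/

section Solutions

/-- For small `ε` the equation `u (n + 1) = a n * u n + ε * b n` has bounded solutions up to an
error that is small compared to `ε`. -/
def IsApproxSolvable (a b : ℕ → ℝ) : Prop :=
  ∀ c > (0 : ℝ), ∀ᶠ ε : ℝ in 𝓝[>] 0, ∃ u : ℕ → ℝ, (∃ B, ∀ n, |u n| ≤ B) ∧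
    ∀ n, |u (n + 1) - a n * u n - ε * b n| ≤ c * ε

theorem IsApproxSolvable.zero (a : ℕ → ℝ) : IsApproxSolvable a 0 := by
  intro c hc
  filter_upwards [self_mem_nhdsWithin] with ε (hε : 0 < ε)
  exact ⟨0, ⟨0, by simp⟩, fun n => by simpa using by positivity⟩

/-- Linearity in (u, b) at a common ε. Shifts in different charts thus never have to be composed:
only their scalar solutions are added. -/
theorem IsApproxSolvable.add {a b b' : ℕ → ℝ} (h : IsApproxSolvable a b)
    (h' : IsApproxSolvable a b') : IsApproxSolvable a (b + b') := by
  intro c hc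
  filter_upwards [h (c / 2) (by positivity), h' (c / 2) (by positivity)]
    with ε ⟨u, ⟨B, hB⟩, hu⟩ ⟨u', ⟨B', hB'⟩, hu'⟩
  refine ⟨u + u', ⟨B + B', fun n => (abs_add_le _ _).trans (add_le_add (hB n) (hB' n))⟩,
    fun n => ?_⟩
  have e : (u + u') (n + 1) - a n * (u + u') n - ε * (b + b') n =
      (u (n + 1) - a n * u n - ε * b n) + (u' (n + 1) - a n * u' n - ε * b' n) := by
    simp only [Pi.add_apply]
    ring
  rw [e]
  refine (abs_add_le _ _).trans ?_
  linarith [hu n, hu' n]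

/-- With tolerance β/2 the error eats at most half of the forcing εβ, which leaves c = εβ/2. -/
theorem IsApproxSolvable.exists_supersolution {a b : ℕ → ℝ} (h : IsApproxSolvable a b) {β : ℝ}
    (hβ : 0 < β) (hb : ∀ n, β ≤ b n) :
    ∃ u : ℕ → ℝ, (∃ B, ∀ n, |u n| ≤ B) ∧ ∃ c > 0, ∀ n, a n * u n + c ≤ u (n + 1) := by
  obtain ⟨ε, ⟨u, hB, hu⟩, hε⟩ := ((h (β / 2) (by positivity)).and self_mem_nhdsWithin).exists
  have hε' : 0 < ε := hε
  refine ⟨u, hB, ε * (β / 2), by positivity, fun n => ?_⟩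
  have h1 := (abs_le.1 (hu n)).1
  have h2 : ε * β ≤ ε * b n := by
    gcongr
    exact hb n
  linarith

end Solutions

/-! ### Passing from the dense orbit to the whole set. -/

section Density

variable {X : Type*} [TopologicalSpace X] {f : X → X} {Λ : Set X} {z : X}

/-- The tails of a dense forward orbit are dense in an invariant set. -/
theorem subset_closure_iterate_tail (hf : Continuous f) (hΛ : f '' Λ = Λ)
    (hz : Λ ⊆ closure (range fun n : ℕ => f^[n] z)) (N : ℕ) :
    Λ ⊆ closure ((fun n : ℕ => f^[n] z) '' Ici N) := by
  induction N with
  | zero => simpa using hz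
  | succ N ih =>
    calc Λ = f '' Λ := hΛ.symm
      _ ⊆ f '' closure ((fun n : ℕ => f^[n] z) '' Ici N) := image_mono ih
      _ ⊆ closure (f '' ((fun n : ℕ => f^[n] z) '' Ici N)) := image_closure_subset_closure_image hf
      _ ⊆ _ := by
        refine closure_mono ?_
        rintro _ ⟨_, ⟨n, hn, rfl⟩, rfl⟩
        exact ⟨n + 1, Nat.succ_le_succ hn, Function.iterate_succ_apply' f n z⟩

/-- A tail is enough because the decay estimate is only known after the time when u becomes
nonnegative. -/
theorem forall_mem_of_iterate_tail (hf : Continuous f) (hΛ : f '' Λ = Λ) (hzΛ : z ∈ Λ)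
    (hz : Λ ⊆ closure (range fun n : ℕ => f^[n] z)) {g : X → ℝ} (hg : ContinuousOn g Λ)
    {S : Set ℝ} (hS : IsClosed S) {N : ℕ} (h : ∀ n ≥ N, g (f^[n] z) ∈ S) {x : X} (hx : x ∈ Λ) :
    g x ∈ S := by
  have hm : MapsTo f Λ Λ := mapsTo_iff_image_subset.2 hΛ.subset
  have hsub : (fun n : ℕ => f^[n] z) '' Ici N ⊆ Λ := by
    rintro _ ⟨n, _, rfl⟩
    exact hm.iterate n hzΛ
  have h1 := ((hg x hx).mono hsub).mem_closure_image (subset_closure_iterate_tail hf hΛ hz N hx)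
  refine hS.closure_subset_iff.2 ?_ h1
  rintro _ ⟨_, ⟨n, hn, rfl⟩, rfl⟩
  exact h n hn

end Density

/-! ### Sums of invariant bundles and growth along the field. -/

section Bundles

variable {E : Type*} [NormedAddCommGroup E] [NormedSpace ℝ E]
  {M : Type*} [TopologicalSpace M] [ChartedSpace E M]
  {Λ : Set M} {F G : ∀ x : M, Submodule ℝ (TangentSpace 𝓘(ℝ, E) x)}
  {r : ℕ} {f : M ≃ₘ^r⟮𝓘(ℝ, E), 𝓘(ℝ, E)⟯ M}

theorem IsDInvariant.sup (hF : IsDInvariant f Λ F) (hG : IsDInvariant f Λ G) :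
    IsDInvariant f Λ fun x => F x ⊔ G x := by
  intro x hx
  rw [Submodule.map_sup, hF x hx, hG x hx]

variable {X : ∀ x : M, TangentSpace 𝓘(ℝ, E) x} {a : M → ℝ}

/-- The derivatives of the iterates of `f` along an invariant field. -/
theorem mfderiv_iterate_field (hr : 1 ≤ r) (hΛ : MapsTo f Λ Λ)
    (ha : ∀ x ∈ Λ, mfderiv 𝓘(ℝ, E) 𝓘(ℝ, E) f x (X x) = a x • X (f x)) {x : M} (hx : x ∈ Λ)
    (n : ℕ) : mfderiv 𝓘(ℝ, E) 𝓘(ℝ, E) (f^[n]) x (X x) =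
      (∏ i ∈ Finset.range n, a (f^[i] x)) • X (f^[n] x) := by
  have hr0 : (r : ℕ∞ω) ≠ 0 := by exact_mod_cast (by lia : r ≠ 0)
  have hit : ∀ n : ℕ, ContMDiff 𝓘(ℝ, E) 𝓘(ℝ, E) r (f^[n]) := by
    intro n
    induction n with
    | zero => exact contMDiff_id
    | succ n ih =>
      rw [Function.iterate_succ']
      exact f.contMDiff.comp ih
  induction n with
  | zero =>
    rw [Finset.range_zero, Finset.prod_empty, one_smul, Function.iterate_zero, mfderiv_id]
    rfl
  | succ n ih =>
    have h1 : mfderiv 𝓘(ℝ, E) 𝓘(ℝ, E) (f ∘ f^[n]) x (X x) =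
        mfderiv 𝓘(ℝ, E) 𝓘(ℝ, E) f (f^[n] x) (mfderiv 𝓘(ℝ, E) 𝓘(ℝ, E) (f^[n]) x (X x)) :=
      mfderiv_comp_apply x (f.contMDiff.mdifferentiableAt hr0) ((hit n).mdifferentiableAt hr0) _
    rw [ih, map_smul, ha _ (hΛ.iterate n hx), smul_smul] at h1
    rw [Finset.prod_range_succ, Function.iterate_succ', Function.comp_apply]
    exact h1

/-- Differentiate f⁻ⁿ ∘ fⁿ = id along `X`. The field on the right is taken at f⁻ⁿ(fⁿ(x)), so that
both sides have the same tangent space as their type. -/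
theorem mfderiv_symm_iterate_field (hr : 1 ≤ r) (hΛ : MapsTo f Λ Λ)
    (ha : ∀ x ∈ Λ, mfderiv 𝓘(ℝ, E) 𝓘(ℝ, E) f x (X x) = a x • X (f x)) {x : M} (hx : x ∈ Λ)
    (n : ℕ) : (∏ i ∈ Finset.range n, a (f^[i] x)) •
      mfderiv 𝓘(ℝ, E) 𝓘(ℝ, E) (f.symm^[n]) (f^[n] x) (X (f^[n] x)) =
        X (f.symm^[n] (f^[n] x)) := by
  have hr0 : (r : ℕ∞ω) ≠ 0 := by exact_mod_cast (by lia : r ≠ 0)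
  have hit : ∀ (g : M ≃ₘ^r⟮𝓘(ℝ, E), 𝓘(ℝ, E)⟯ M) (n : ℕ),
      ContMDiff 𝓘(ℝ, E) 𝓘(ℝ, E) r (g^[n]) := by
    intro g n
    induction n with
    | zero => exact contMDiff_id
    | succ n ih =>
      rw [Function.iterate_succ']
      exact g.contMDiff.comp ih
  have h1 : mfderiv 𝓘(ℝ, E) 𝓘(ℝ, E) (f.symm^[n] ∘ f^[n]) x (X x) =
      mfderiv 𝓘(ℝ, E) 𝓘(ℝ, E) (f.symm^[n]) (f^[n] x)
        (mfderiv 𝓘(ℝ, E) 𝓘(ℝ, E) (f^[n]) x (X x)) :=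
    mfderiv_comp_apply x ((hit _ n).mdifferentiableAt hr0) ((hit _ n).mdifferentiableAt hr0) _
  have h2 : f.symm^[n] ∘ f^[n] = id := by
    funext y
    exact Function.LeftInverse.iterate f.symm_apply_apply n y
  rw [mfderiv_iterate_field hr hΛ ha hx n, map_smul] at h1
  rw [← h1]
  have h3 := (Filter.EventuallyEq.of_eq (l := 𝓝 x) h2).mfderiv_eq (I := 𝓘(ℝ, E)) (I' := 𝓘(ℝ, E))
  have h4 := congrArg (fun L => L (X x)) h3
  rw [mfderiv_id] at h4
  have h5 : ∀ y, y = x → (X y : E) = X x := by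
    rintro y rfl
    rfl
  exact h4.trans (h5 _ (congrFun h2 x)).symm

theorem ContinuousField.mono [IsManifold 𝓘(ℝ, E) 1 M] {S T : Set M} {Y : ∀ x : M, TangentSpace 𝓘(ℝ, E) x}
    (h : ContinuousField T Y) (hST : S ⊆ T) : ContinuousField S Y :=
  ContinuousOn.mono h hST

theorem IsSubbundle.sup [IsManifold 𝓘(ℝ, E) 1 M] (hF : IsSubbundle Λ F) (hG : IsSubbundle Λ G)
    (hd : ∀ x ∈ Λ, Disjoint (F x) (G x)) : IsSubbundle Λ fun x => F x ⊔ G x := by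
  intro x hx
  obtain ⟨U, hU, k, b, hbc, hb⟩ := hF x hx
  obtain ⟨U', hU', k', b', hbc', hb'⟩ := hG x hx
  refine ⟨U ∩ U', inter_mem hU hU', k + k', Fin.append b b', fun j => ?_, ?_⟩
  · refine Fin.addCases (fun i => ?_) (fun i => ?_) j
    · rw [Fin.append_left]
      exact (hbc i).mono fun y hy => ⟨hy.1.1, hy.2⟩
    · rw [Fin.append_right]
      exact (hbc' i).mono fun y hy => ⟨hy.1.2, hy.2⟩
  · rintro y ⟨⟨hy, hy'⟩, hyΛ⟩
    obtain ⟨li, sp⟩ := hb y ⟨hy, hyΛ⟩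
    obtain ⟨li', sp'⟩ := hb' y ⟨hy', hyΛ⟩
    have e : (fun j => Fin.append b b' j y) ∘ finSumFinEquiv =
        Sum.elim (fun i => b i y) fun i => b' i y := by
      funext i
      rcases i with i | i
      · simp
      · simp
    constructor
    · rw [← linearIndependent_equiv finSumFinEquiv, e]
      refine li.sum_type li' ?_
      rw [sp, sp']
      exact hd y hyΛ
    · rw [← EquivLike.range_comp (fun j => Fin.append b b' j y) finSumFinEquiv, e,
        Sum.elim_range, Submodule.span_union, sp, sp']

variable [RiemannianBundle (fun x : M => TangentSpace 𝓘(ℝ, E) x)]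

/-- Adding a contracted line to a contracted bundle. -/
theorem IsContracted.sup_span (hF : IsContracted f Λ F)
    {θ : ∀ x : M, TangentSpace 𝓘(ℝ, E) x →ₗ[ℝ] ℝ} {K C μ : ℝ} (hK : 0 < K) (hC : 0 < C)
    (hμ : 0 < μ) (hμ1 : μ < 1)
    (hθ : ∀ x ∈ Λ, ∀ v : TangentSpace 𝓘(ℝ, E) x, |θ x v| ≤ K * ‖v‖)
    (hθX : ∀ x ∈ Λ, θ x (X x) = 1) (hθF : ∀ x ∈ Λ, ∀ v ∈ F x, θ x v = 0)
    (hX : ∀ x ∈ Λ, ‖X x‖ = 1)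
    (hXn : ∀ x ∈ Λ, ∀ n : ℕ, ‖mfderiv 𝓘(ℝ, E) 𝓘(ℝ, E) (f^[n]) x (X x)‖ ≤ C * μ ^ n)
    (hG : ∀ x ∈ Λ, G x = Submodule.span ℝ {X x}) :
    IsContracted f Λ fun x => F x ⊔ G x := by
  obtain ⟨C', hC', lam, hlam, hlam1, h⟩ := hF
  refine ⟨C' * (1 + K) + C * K, by positivity, max lam μ, lt_max_of_lt_left hlam,
    max_lt hlam1 hμ1, fun x hx v hv n => ?_⟩
  change v ∈ F x ⊔ G x at hv
  rw [hG x hx] at hv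
  obtain ⟨w, hw, t, ht, rfl⟩ := Submodule.mem_sup.1 hv
  obtain ⟨s, rfl⟩ := Submodule.mem_span_singleton.1 ht
  -- The coefficient s is the value of θ on the sum, so the bound on θ controls both components and
  -- no angle estimate is needed.
  have hs : |s| ≤ K * ‖w + s • X x‖ := by
    have := hθ x hx (w + s • X x)
    rwa [map_add, map_smul, hθF x hx w hw, hθX x hx, zero_add, smul_eq_mul, mul_one] at this
  have hsX : ‖s • X x‖ = |s| := by rw [norm_smul, hX x hx, mul_one, Real.norm_eq_abs]
  have hw' : ‖w‖ ≤ (1 + K) * ‖w + s • X x‖ := by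
    have h1 : ‖w‖ ≤ ‖w + s • X x‖ + ‖s • X x‖ := by
      simpa using norm_sub_le (w + s • X x) (s • X x)
    rw [hsX] at h1
    linarith
  have hl : lam ^ n ≤ max lam μ ^ n := by
    gcongr
    exact le_max_left _ _
  have hm : μ ^ n ≤ max lam μ ^ n := by
    gcongr
    exact le_max_right _ _
  rw [map_add, map_smul]
  calc _ ≤ ‖mfderiv 𝓘(ℝ, E) 𝓘(ℝ, E) (f^[n]) x w‖ +
        ‖s • mfderiv 𝓘(ℝ, E) 𝓘(ℝ, E) (f^[n]) x (X x)‖ := norm_add_le _ _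
    _ ≤ C' * lam ^ n * ‖w‖ + |s| * (C * μ ^ n) := by
        rw [norm_smul, Real.norm_eq_abs]
        gcongr
        · exact h x hx w hw n
        · exact hXn x hx n
    _ ≤ C' * max lam μ ^ n * ((1 + K) * ‖w + s • X x‖) +
        K * ‖w + s • X x‖ * (C * max lam μ ^ n) := by gcongr
    _ = _ := by ring

end Bundles

/-! ### A forcing term that is positive on all of `Λ`. -/

section Existence

variable {E : Type*} [NormedAddCommGroup E] [NormedSpace ℝ E] [FiniteDimensional ℝ E]
  {M : Type*} [EMetricSpace M] [ChartedSpace E M] [IsManifold 𝓘(ℝ, E) 1 M]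
  [RiemannianBundle (fun x : M => TangentSpace 𝓘(ℝ, E) x)]
  [IsContinuousRiemannianBundle E (fun x : M => TangentSpace 𝓘(ℝ, E) x)]
  [IsRiemannianManifold 𝓘(ℝ, E) M]

/-- Hölder stability with exponent larger than `1 / 2` yields bounded approximate solutions of the
cohomological equation over an orbit, with a positive right-hand side. -/
theorem IsHolderStable.exists_isApproxSolvable {r : ℕ} (hr : 2 ≤ r)
    {f : M ≃ₘ^r⟮𝓘(ℝ, E), 𝓘(ℝ, E)⟯ M} {Λ : Set M} (hΛc : IsCompact Λ) (hΛ : MapsTo f Λ Λ)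
    {z : M} (hz : z ∈ Λ) {α : ℝ} (hα : 1 / 2 < α) (hstable : IsHolderStable f Λ α)
    {a : M → ℝ} {X : ∀ x : M, TangentSpace 𝓘(ℝ, E) x}
    {θ : ∀ x : M, TangentSpace 𝓘(ℝ, E) x →ₗ[ℝ] ℝ}
    (hθX : ∀ x ∈ Λ, θ x (X x) = 1)
    (hθc : ∀ χ ∈ IsManifold.maximalAtlas 𝓘(ℝ, E) 1 M, ∀ l : M → E →L[ℝ] ℝ,
      (∀ x ∈ χ.source, ∀ u, l x (chartDeriv χ x u) = θ x u) → ∀ x ∈ Λ, x ∈ χ.source →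
        ContinuousWithinAt l Λ x)
    (hθ : ∀ x ∈ Λ, ∀ u, θ (f x) (mfderiv 𝓘(ℝ, E) 𝓘(ℝ, E) f x u) = a x * θ x u) :
    ∃ b : M → ℝ, (∀ x ∈ Λ, 1 / 4 ≤ b x) ∧
      IsApproxSolvable (fun n => a (f^[n] z)) fun n => b (f^[n + 1] z) := by
  obtain ⟨A, hA, ε₀, hε₀, C, hC, hst⟩ := hstable
  have hr' : (1 : ℕ∞ω) ≤ r := by exact_mod_cast (by lia : 1 ≤ r)
  have hχ1 : ∀ i, A.χ i ∈ IsManifold.maximalAtlas 𝓘(ℝ, E) 1 M := fun i =>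
    IsManifold.maximalAtlas_subset_of_le hr' (A.χ_mem i)
  choose l hl using fun i => exists_chart_form (A.χ i) (hχ1 i) θ
  have hlc : ∀ i, ∀ x ∈ Λ, x ∈ (A.χ i).source → ContinuousWithinAt (l i) Λ x := fun i =>
    hθc _ (hχ1 i) _ (hl i)
  have hlocal : ∀ p ∈ Λ, ∃ b : M → ℝ, (∀ x ∈ Λ, 0 ≤ b x) ∧ (∀ᶠ x in 𝓝[Λ] p, 1 / 4 ≤ b x) ∧
      IsApproxSolvable (fun n => a (f^[n] z)) fun n => b (f^[n + 1] z) := by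
    intro p hp
    obtain ⟨j, hj⟩ : ∃ j, p ∈ A.K j := mem_iUnion.1 (A.iUnion_K ▸ mem_univ p)
    have hpj := A.K_subset j hj
    -- The shift direction is `X p` frozen in the chart. By continuity θ of this constant field
    -- exceeds 1/2 near p, and the bump is supported there; where it also exceeds 1/2, the product
    -- exceeds 1/4.
    let v : E := chartDeriv (A.χ j) p (X p)
    have hlv : ContinuousWithinAt (fun q => l j q v) Λ p := (hlc j p hp hpj).clm_apply
      continuousWithinAt_const
    have hlv1 : l j p v = 1 := by rw [hl j p hpj, hθX p hp]
    obtain ⟨O, hO, hOo, hpO⟩ := mem_nhdsWithin.1 (hlv.eventually (lt_mem_nhds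
      (show (1 : ℝ) / 2 < l j p v by rw [hlv1]; norm_num)))
    have hN : (A.χ j).target ∩ (A.χ j).symm ⁻¹' O ∈ 𝓝 (A.χ j p) :=
      ((A.χ j).isOpen_inter_preimage_symm hO).mem_nhds
        ⟨(A.χ j).map_source hpj, by simpa [(A.χ j).left_inv hpj] using hOo⟩
    obtain ⟨ρ, hρs, hρc, hρ, hρr, hρ1⟩ := exists_contDiff_tsupport_subset (n := (⊤ : ℕ∞)) hN
    have hρ0 : ∀ w, 0 ≤ ρ w := fun w => (hρr ⟨w, rfl⟩).1
    have hVex : ∀ q : M, ∃ V : TangentSpace 𝓘(ℝ, E) q,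
        (q ∈ (A.χ j).source → chartDeriv (A.χ j) q V = ρ (A.χ j q) • v) ∧
        (q ∉ (A.χ j).source → V = 0) := by
      intro q
      by_cases hq : q ∈ (A.χ j).source
      · obtain ⟨V, hV⟩ := (chartDeriv_bijective (hχ1 j) hq).2 (ρ (A.χ j q) • v)
        exact ⟨V, fun _ => hV, fun h => absurd hq h⟩
      · exact ⟨0, fun h => absurd h hq, fun _ => rfl⟩
    choose V hV hV' using hVex
    have hbV : ∀ q ∈ (A.χ j).source, θ q (V q) = ρ (A.χ j q) * l j q v := fun q hq => by
      rw [← hl j q hq, hV q hq, map_smul, smul_eq_mul]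
    have hbρ : ∀ q ∈ Λ, q ∈ (A.χ j).source → ρ (A.χ j q) / 2 ≤ θ q (V q) := by
      intro q hqΛ hq
      rw [hbV q hq]
      by_cases h0 : ρ (A.χ j q) = 0
      · simp [h0]
      · have h1 := (hρs (subset_tsupport _ h0)).2
        rw [mem_preimage, (A.χ j).left_inv hq] at h1
        have h2 : (1 : ℝ) / 2 < l j q v := hpO ⟨h1, hqΛ⟩
        nlinarith [hρ0 (A.χ j q)]
    refine ⟨fun q => θ q (V q), fun x hx => ?_, ?_, fun c hc => ?_⟩
    · by_cases hxs : x ∈ (A.χ j).source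
      · exact (div_nonneg (hρ0 _) (by norm_num)).trans (hbρ x hx hxs)
      · simp [hV' x hxs]
    · have h1 : ∀ᶠ x in 𝓝 p, (1 : ℝ) / 2 < ρ (A.χ j x) :=
        ((hρ.continuous.continuousAt).comp ((A.χ j).continuousAt hpj)).eventually
          (lt_mem_nhds (by rw [Function.comp_apply, hρ1]; norm_num))
      filter_upwards [self_mem_nhdsWithin, mem_nhdsWithin_of_mem_nhds h1,
        mem_nhdsWithin_of_mem_nhds ((A.χ j).open_source.mem_nhds hpj)] with x hx hx1 hxs
      linarith [hbρ x hx hxs]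
    · exact eventually_exists_approximate_solution hr hΛc hΛ hz hA hα hε₀ (C := C)
        (fun g hg hgd => (hst g hg hgd).imp fun φ h => h.2) hl hlc hθ hρ hρc
        (hρs.trans inter_subset_left) hV hV' hc
  -- Nonnegativity on all of `Λ` is carried along so that adding another forcing term never spoils a
  -- lower bound already gained.
  obtain ⟨b, -, hb, hsol⟩ := hΛc.induction_on (p := fun s => ∃ b : M → ℝ, (∀ x ∈ Λ, 0 ≤ b x) ∧
      (∀ x ∈ s ∩ Λ, 1 / 4 ≤ b x) ∧
      IsApproxSolvable (fun n => a (f^[n] z)) fun n => b (f^[n + 1] z))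
    ⟨0, by simp, by simp, IsApproxSolvable.zero _⟩
    (fun s t hst ⟨b, h0, h1, h2⟩ => ⟨b, h0, fun x hx => h1 x ⟨hst hx.1, hx.2⟩, h2⟩)
    (fun s t ⟨b, h0, h1, h2⟩ ⟨b', h0', h1', h2'⟩ => ⟨b + b',
      fun x hx => add_nonneg (h0 x hx) (h0' x hx), fun x hx => by
        rw [Pi.add_apply]
        rcases hx.1 with h | h
        · linarith [h1 x ⟨h, hx.2⟩, h0' x hx.2]
        · linarith [h1' x ⟨h, hx.2⟩, h0 x hx.2], h2.add h2'⟩)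
    (fun p hp => by
      obtain ⟨b, h0, h1, h2⟩ := hlocal p hp
      exact ⟨_, h1, b, h0, fun x hx => hx.1, h2⟩)
  exact ⟨b, fun x hx => hb x ⟨hx, hx⟩, hsol⟩

end Existence

end HolderStability

end

/-! ### The dichotomy and the hyperbolic splitting. -/

theorem corollary1p3
    {E : Type*} [NormedAddCommGroup E] [NormedSpace ℝ E] [FiniteDimensional ℝ E]
    {M : Type*} [EMetricSpace M] [SecondCountableTopology M] [ChartedSpace E M]
    (r : ℕ) (hr : 2 ≤ r)
    [IsManifold 𝓘(ℝ, E) r M] [IsManifold 𝓘(ℝ, E) 1 M]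
    [RiemannianBundle (fun x : M => TangentSpace 𝓘(ℝ, E) x)]
    [IsContinuousRiemannianBundle E (fun x : M => TangentSpace 𝓘(ℝ, E) x)]
    [IsRiemannianManifold 𝓘(ℝ, E) M]
    (f : M ≃ₘ^r⟮𝓘(ℝ, E), 𝓘(ℝ, E)⟯ M)
    (Λ : Set M) (hcompact : IsCompact Λ) (hinv : f '' Λ = Λ)
    (htrans : HolderStability.IsTransitive f Λ)
    (Es Ec Eu : ∀ x : M, Submodule ℝ (TangentSpace 𝓘(ℝ, E) x))
    (hph : HolderStability.IsPartiallyHyperbolic f Λ Es Ec Eu)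
    (hdim : ∀ x ∈ Λ, Module.finrank ℝ (Ec x) = 1)
    (X : ∀ x : M, TangentSpace 𝓘(ℝ, E) x)
    (horient : HolderStability.IsOrientation Λ Ec X)
    (hpres : HolderStability.PreservesOrientation f Λ X)
    (α : ℝ) (hα : 1 / 2 < α)
    (hstable : HolderStability.IsHolderStable f Λ α) :
    HolderStability.IsHyperbolic f Λ := by
  obtain ⟨a, hac, ha⟩ := hpres
  obtain ⟨z, hz, hdense⟩ := htrans
  have hΛ : MapsTo f Λ Λ := mapsTo_iff_image_subset.2 hinv.subset
  have hmem : ∀ n, f^[n] z ∈ Λ := fun n => hΛ.iterate n hz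
  obtain ⟨θ, hθ⟩ := hph.exists_isCentreForm horient
  have hspan : ∀ x ∈ Λ, Es x ⊔ Submodule.span ℝ {X x} ⊔ Eu x = ⊤ := fun x hx =>
    hph.sup_span_eq_top hdim horient hx
  have hdis : ∀ x ∈ Λ, Disjoint (Es x) (Eu x) := fun x hx => hph.disjoint_s_u hx
  have hX1 : ∀ x ∈ Λ, ‖X x‖ = 1 := fun x hx => (horient.2 x hx).2
  have hda : ∀ x ∈ Λ, mfderiv 𝓘(ℝ, E) 𝓘(ℝ, E) f x (X x) = a x • X (f x) := fun x hx =>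
    (ha x hx).2
  obtain ⟨K, hK, hKθ⟩ := hθ.exists_bound hcompact hph.subbundle_s hph.subbundle_u horient.1
    hspan hdis
  obtain ⟨b, hb, hsol⟩ := hstable.exists_isApproxSolvable hr hcompact hΛ hz hα hθ.apply_field
    (fun χ hχ l hl x hx hxχ => hθ.continuousWithinAt hph.subbundle_s hph.subbundle_u horient.1
      hspan hdis hχ hl hx hxχ)
    (fun x hx u => hθ.apply_mfderiv hph.invariant_s hph.invariant_u hspan hΛ hda hx u)
  obtain ⟨u, ⟨B, hB⟩, c, hc, hu⟩ := hsol.exists_supersolution (by norm_num)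
    fun n => hb _ (hmem (n + 1))
  obtain ⟨Amax, hAmax⟩ := (hcompact.image_of_continuousOn hac).bddAbove
  obtain ⟨C, hC, μ, hμ, hμ1, hcase⟩ := HolderStability.prod_decay_or_growth hc (fun n => (ha _ (hmem n)).1)
    (fun n => hAmax (mem_image_of_mem a (hmem n))) hB hu
  have hprodc : ∀ k, ContinuousOn (fun x => ∏ i ∈ Finset.range k, a (f^[i] x)) Λ := fun k =>
    continuousOn_finsetProd _ fun i _ =>
      hac.comp (f.continuous.iterate i).continuousOn (hΛ.iterate i)
  have hshift : ∀ n k, ∏ i ∈ Finset.range k, a (f^[i] (f^[n] z)) =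
      ∏ i ∈ Finset.range k, a (f^[n + i] z) := fun n k => by
    refine Finset.prod_congr rfl fun i _ => ?_
    rw [← Function.iterate_add_apply, add_comm]
  have hspanc : ∀ x ∈ Λ, Ec x = Submodule.span ℝ {X x} := fun x hx =>
    (HolderStability.span_field_eq hdim horient hx).symm
  have hdcu : ∀ x ∈ Λ, Disjoint (Ec x) (Eu x) := fun x hx =>
    (hph.isCompl_sc_u x hx).disjoint.mono_left le_sup_right
  rcases hcase with ⟨N, hN⟩ | hN
  · -- the centre direction is contracted
    have hdecay : ∀ x ∈ Λ, ∀ n, ∏ i ∈ Finset.range n, a (f^[i] x) ≤ C * μ ^ n := fun x hx n =>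
      HolderStability.forall_mem_of_iterate_tail f.continuous hinv hz hdense (hprodc n) isClosed_Iic
        (fun m hm => by
          rw [hshift]
          exact hN m hm n) hx
    refine ⟨fun x => Es x ⊔ Ec x, Eu, hph.subbundle_s.sup hph.subbundle_c hph.disjoint_s_c,
      hph.subbundle_u, hph.invariant_s.sup hph.invariant_c, hph.invariant_u, hph.isCompl_sc_u,
      ?_, hph.contracted_u⟩
    refine hph.contracted_s.sup_span hK hC hμ hμ1 hKθ hθ.apply_field hθ.apply_s hX1
      (fun x hx n => ?_) hspanc
    rw [HolderStability.mfderiv_iterate_field (by lia) hΛ hda hx n, norm_smul, hX1 _ (hΛ.iterate n hx), mul_one,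
      Real.norm_of_nonneg (Finset.prod_nonneg fun i _ => (ha _ (hΛ.iterate i hx)).1.le)]
    exact hdecay x hx n
  · -- the centre direction is expanded
    have hgrow : ∀ x ∈ Λ, ∀ n, 1 ≤ C * μ ^ n * ∏ i ∈ Finset.range n, a (f^[i] x) := fun x hx n =>
      HolderStability.forall_mem_of_iterate_tail (S := Ici 1) (N := 0) f.continuous hinv hz hdense
        (g := fun x => C * μ ^ n * ∏ i ∈ Finset.range n, a (f^[i] x))
        (continuousOn_const.mul (hprodc n)) isClosed_Ici
        (fun m _ => by
          rw [hshift]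
          exact hN m n) hx
    have hcompl : ∀ x ∈ Λ, IsCompl (Es x) (Eu x ⊔ Ec x) := fun x hx => by
      refine ⟨?_, ?_⟩
      · rw [sup_comm]
        exact (hph.disjoint_s_c x hx).disjoint_sup_right_of_disjoint_sup_left
          (hph.isCompl_sc_u x hx).disjoint
      · rw [codisjoint_iff, sup_comm (Eu x), ← sup_assoc]
        exact (hph.isCompl_sc_u x hx).sup_eq_top
    refine ⟨Es, fun x => Eu x ⊔ Ec x, hph.subbundle_s, hph.subbundle_u.sup hph.subbundle_c
      (fun x hx => (hdcu x hx).symm), hph.invariant_s, hph.invariant_u.sup hph.invariant_c, hcompl,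
      hph.contracted_s, ?_⟩
    refine hph.contracted_u.sup_span hK hC hμ hμ1 hKθ hθ.apply_field hθ.apply_u hX1
      (fun x hx n => ?_) hspanc
    -- Backward contraction at x is forward growth along the orbit segment that ends at x, so x is
    -- written as fⁿ(y) with y in `Λ`.
    obtain ⟨y, hy, rfl⟩ : ∃ y ∈ Λ, f^[n] y = x := by
      have himg : f^[n] '' Λ = Λ := by
        rw [image_iterate_eq]
        exact Function.iterate_fixed hinv n
      have hx' : x ∈ f^[n] '' Λ := by rwa [himg]
      exact hx'
    have h1 := congrArg (fun w => ‖w‖) (HolderStability.mfderiv_symm_iterate_field (by lia) hΛ hda hy n)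
    have hpos : 0 < ∏ i ∈ Finset.range n, a (f^[i] y) :=
      Finset.prod_pos fun i _ => (ha _ (hΛ.iterate i hy)).1
    have h2 := hgrow y hy n
    have hL : f.symm^[n] (f^[n] y) = y := Function.LeftInverse.iterate f.symm_apply_apply n y
    rw [norm_smul, Real.norm_of_nonneg hpos.le, hX1 _ (hL.symm ▸ hy)] at h1
    set t := ‖mfderiv 𝓘(ℝ, E) 𝓘(ℝ, E) (f.symm^[n]) (f^[n] y) (X (f^[n] y))‖ with ht
    calc t = 1 * t := (one_mul t).symm
      _ ≤ C * μ ^ n * (∏ i ∈ Finset.range n, a (f^[i] y)) * t :=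
        mul_le_mul_of_nonneg_right h2 (norm_nonneg _)
      _ = C * μ ^ n := by rw [mul_assoc, h1, mul_one]
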